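/- Let $n\ge 1$, let $\Omega_1',\dots,\Omega_n'$ be finite sets, and let $\mu$ be a probability distribution on $\Omega_1'\times\cdots\times\Omega_n'$. Let $\Omega=\bigsqcup_{i=1}^n\Omega_i'=\bigcup_{i=1}^n \Omega_i'\times\{i\}$ and let $\binom{\Omega}{k}$ denote the family of $k$-element subsets of $\Omega$. The homogenization $\mu^{\mathrm{hom}}$ of $\mu$ is the distribution on $\binom{\Omega}{n}$ obtained by identifying $\sigma$ with $\{(\sigma_1,1),\dots,(\sigma_n,n)\}$. For $0\le \ell\le k\le n$ let $D_{k\to\ell}(A,B)=\mathbf 1_{B\subseteq A}\binom{k}{\ell}^{-1}$ be the down operator, a Markov kernel from $\binom{\Omega}{k}$ to $\binom{\Omega}{\ell}$, and let $\mu_k=\mu^{\mathrm{hom}}D_{n\to k}$. Let $$U_{\ell\to k}(B,A)=\mathbf 1_{B\subseteq A}\frac{\mu_k(A)}{\sum_{A'\supseteq B}\mu_k(A')}$$ be the up operator from $\binom{\Omega}{\ell}$ to $\binom{\Omega}{k}$ (defined for $B$ in the support of $\mu_\ell$), and let $P_{k\leftrightarrow\ell}=D_{k\to\ell}U_{\ell\to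 k}$ be the $k\leftrightarrow\ell$ down-up walk. For probability distributions $\nu\ll\pi$ on a finite set let $D_f(\nu\|\pi)=\mathbb E_{x\sim\pi} f(\nu(x)/\pi(x))$, with $f(x)=(x-1)^2$ for the $\chi^2$-divergence and $f(x)=x\ln x$ (where $0\ln 0=0$) for the KL-divergence. A kernel $P$ satisfies $\rho$-contraction in $D_f$ with respect to $\pi$ if $D_f(\nu P\|\pi P)\le\rho\, D_f(\nu\|\pi)$ for all probability distributions $\nu\ll\pi$. Below, contraction of $D_{k\to\ell}$ and of $P_{k\leftrightarrow\ell}$ is with respect to $\mu_k$ (so that of $D_{n\to n-1}$ is with respect to $\mu_n=\mu^{\mathrm{hom}}$). Let $C>0$. Then: 1. If $D_{n\to n-1}$ satisfies $\left(1-\frac{1}{Cn}\right)$-contraction in $\chi^2$-divergence, then for all $0\le\ell\le k\le n$, $D_{k\to\ell}$ satisfies $\prod_{j=\ell+1}^{k}\left(1-\frac{1}{j\left(C+\frac{n-j+1}{n}\right)}\right)$-contraction in $\chi^2$-divergence. 2. If $D_{n\to n-1}$ satisfies $\left(1-\frac{1}{Cn}\right)$-contraction in KL-divergence (that is, $\mu$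 satisfies $C$-approximate tensorization of entropy), then for all $0\le\ell\le k\le n$, both $D_{k\to\ell}$ and $P_{k\leftrightarrow\ell}$ satisfy $\prod_{j=\ell+1}^{k}\left(1-\frac{1}{j(C+1)}\right)$-contraction in KL-divergence. -/

import Mathlib

namespace DownUp

open scoped Matrix

/-- The family of all `k`-element subsets of a finite set `Ω`. -/
abbrev Slice (Ω : Type*) (k : ℕ) : Type _ := {S : Finset Ω // S.card = k}

/-- The `f`-divergence `D_f(ν ‖ μ) = E_{x ∼ μ} f (ν x / μ x)` of probability mass functions
on a finite set. It is only used for `ν ≪ μ`. -/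
noncomputable def fDiv {α : Type*} [Fintype α] (f : ℝ → ℝ) (ν μ : α → ℝ) : ℝ :=
  ∑ x, μ x * f (ν x / μ x)

/-- The function whose `f`-divergence is the `χ²`-divergence. -/
def chiSqFun (x : ℝ) : ℝ := (x - 1) ^ 2

/-- The function whose `f`-divergence is the KL-divergence. -/
noncomputable def klFun (x : ℝ) : ℝ := x * Real.log x

/-- The kernel `P` from `α` to `β` satisfies `ρ`-contraction in `f`-divergence with respect to
`μ`: for every probability mass function `ν ≪ μ`, `D_f(νP ‖ μP) ≤ ρ D_f(ν ‖ μ)`. -/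
def Contracts {α β : Type*} [Fintype α] [Fintype β] (f : ℝ → ℝ) (P : Matrix α β ℝ) (ρ : ℝ)
    (μ : α → ℝ) : Prop :=
  ∀ ν ∈ stdSimplex ℝ α, (∀ x, μ x = 0 → ν x = 0) →
    fDiv f (ν ᵥ* P) (μ ᵥ* P) ≤ ρ * fDiv f ν μ

/-- The down operator `D_{k → ℓ}`: pass to a uniformly random `ℓ`-element subset. -/
noncomputable def down (Ω : Type*) [DecidableEq Ω] (k ℓ : ℕ) :
    Matrix (Slice Ω k) (Slice Ω ℓ) ℝ :=
  fun A B => if B.1 ⊆ A.1 then 1 / (k.choose ℓ : ℝ) else 0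

/-- The up operator `U_{ℓ → k}` with respect to a distribution `μ` on the `k`-element subsets.
(Rows of sets `B` that no set in the support of `μ` contains are zero; such `B` have probability
zero under `μ D_{k → ℓ}`.) -/
noncomputable def up {Ω : Type*} [Fintype Ω] [DecidableEq Ω] {k : ℕ} (ℓ : ℕ)
    (μ : Slice Ω k → ℝ) : Matrix (Slice Ω ℓ) (Slice Ω k) ℝ :=
  fun B A => if B.1 ⊆ A.1 then μ A / ∑ A' : Slice Ω k with B.1 ⊆ A'.1, μ A' else 0

/-- The `k ↔ ℓ` down-up walk `D_{k → ℓ} U_{ℓ → k}` with respect to a distribution `μ` on the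
`k`-element subsets. -/
noncomputable def downUpWalk {Ω : Type*} [Fintype Ω] [DecidableEq Ω] {k : ℕ} (ℓ : ℕ)
    (μ : Slice Ω k → ℝ) : Matrix (Slice Ω k) (Slice Ω k) ℝ :=
  down Ω k ℓ * up ℓ μ

/-- The identification of `σ ∈ Ω'₁ × ⋯ × Ω'ₙ` with the `n`-element subset
`{(1, σ₁), …, (n, σₙ)}` of the disjoint union of the `Ω'ᵢ`. -/
def toSlice {n : ℕ} {Ω' : Fin n → Type*} (σ : ∀ i, Ω' i) : Slice (Σ i, Ω' i) n :=
  ⟨Finset.univ.map ⟨fun i => ⟨i, σ i⟩, fun _ _ h => congrArg Sigma.fst h⟩, by simp⟩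

/-- The homogenization of a distribution on a product space: its image under `toSlice`. -/
noncomputable def homogenization {n : ℕ} {Ω' : Fin n → Type*} [∀ i, Fintype (Ω' i)]
    [∀ i, DecidableEq (Ω' i)] (μ : (∀ i, Ω' i) → ℝ) : Slice (Σ i, Ω' i) n → ℝ :=
  fun S => ∑ σ : (∀ i, Ω' i) with toSlice σ = S, μ σ

/-- The distribution `μ_k = μ^hom D_{n → k}` on the `k`-element subsets. -/
noncomputable def homLevel {n : ℕ} {Ω' : Fin n → Type*} [∀ i, Fintype (Ω' i)]
    [∀ i, DecidableEq (Ω' i)] (μ : (∀ i, Ω' i) → ℝ) (k : ℕ) : Slice (Σ i, Ω' i) k → ℝ :=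
  homogenization μ ᵥ* down (Σ i, Ω' i) n k

end DownUp

/-!
Write the density of a distribution on the `(j + 1)`-element sets as a function of a random
coordinate set `S` and of the point `σ` restricted to `S`. The chain rule splits its divergence into
the expected `φ`-entropy given `S` and the divergence of the law of `S`. Approximate tensorization
passes to every coordinate set, because coordinates outside `S` do not contribute, and it makes the
first part contract with rate `1 - 1 / (C * (j + 1))`. The second part lives on the complete complex
on `Fin n`, where the contraction rate is `1 - 1 / ((j + 1) * a)` with `a = 1` for the
KL-divergence and `a = (n - j) / n` for the `χ²`-divergence, by induction on `j` from a convexity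
inequality for symmetric functions of two points. So level `j + 1` contracts with the worse rate
`1 - 1 / ((j + 1) * max C a)`, where `max C a ≤ C + a`, and the rates multiply along the levels.
-/

namespace DownUp

open Finset
open scoped Matrix BigOperators

theorem sum_mul_map_div_le {α : Type*} {s : Finset α} {f : ℝ → ℝ} (hf : ConvexOn ℝ (Set.Ici 0) f)
    {w u : α → ℝ} (hw : ∀ x ∈ s, 0 ≤ w x) (hu : ∀ x ∈ s, 0 ≤ u x) :
    (∑ x ∈ s, w x) * f ((∑ x ∈ s, w x * u x) / ∑ x ∈ s, w x) ≤ ∑ x ∈ s, w x * f (u x) := by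
  rcases (sum_nonneg hw).eq_or_lt with h | h
  · have hw₀ := (sum_eq_zero_iff_of_nonneg hw).1 h.symm
    rw [← h, zero_mul, sum_eq_zero fun x hx => by rw [hw₀ x hx, zero_mul]]
  · have hj := hf.map_centerMass_le hw h hu
    simp only [centerMass, smul_eq_mul, Function.comp_apply, inv_mul_eq_div] at hj
    rwa [le_div_iff₀' h] at hj

section Kernel

variable {α β : Type*} [Fintype α]

theorem vecMul_nonneg {ν : α → ℝ} {P : Matrix α β ℝ} (hν : 0 ≤ ν) (hP : ∀ x y, 0 ≤ P x y)
    (y : β) : 0 ≤ (ν ᵥ* P) y :=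
  sum_nonneg fun x _ => mul_nonneg (hν x) (hP x y)

theorem vecMul_mem_stdSimplex [Fintype β] {ν : α → ℝ} {P : Matrix α β ℝ}
    (hν : ν ∈ stdSimplex ℝ α) (hP : ∀ x y, 0 ≤ P x y) (hP₁ : ∀ x, ∑ y, P x y = 1) :
    ν ᵥ* P ∈ stdSimplex ℝ β := by
  refine ⟨vecMul_nonneg hν.1 hP, ?_⟩
  simp only [Matrix.vecMul, dotProduct]
  rw [sum_comm]
  simpa only [← mul_sum, hP₁, mul_one] using hν.2

theorem vecMul_eq_zero_of_vecMul_eq_zero {μ ν : α → ℝ} {P : Matrix α β ℝ} (hμ : 0 ≤ μ)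
    (hP : ∀ x y, 0 ≤ P x y) (hνμ : ∀ x, μ x = 0 → ν x = 0) {y : β} (hy : (μ ᵥ* P) y = 0) :
    (ν ᵥ* P) y = 0 := by
  refine sum_eq_zero fun x _ => ?_
  have h : μ x * P x y = 0 :=
    (sum_eq_zero_iff_of_nonneg fun x _ => mul_nonneg (hμ x) (hP x y)).1 hy x (mem_univ x)
  rcases mul_eq_zero.1 h with h | h
  · rw [hνμ x h, zero_mul]
  · exact mul_eq_zero_of_right _ h

theorem fDiv_eq_sum_mul_map (f : ℝ → ℝ) {ν μ g : α → ℝ} (hν : ∀ x, ν x = μ x * g x) :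
    fDiv f ν μ = ∑ x, μ x * f (g x) := by
  refine sum_congr rfl fun x _ => ?_
  by_cases hx : μ x = 0
  · rw [hx, zero_mul, zero_mul]
  · rw [hν, mul_div_cancel_left₀ _ hx]

theorem fDiv_vecMul_le [Fintype β] {f : ℝ → ℝ} (hf : ConvexOn ℝ (Set.Ici 0) f) {μ ν : α → ℝ}
    {P : Matrix α β ℝ} (hμ : 0 ≤ μ) (hν : 0 ≤ ν) (hP : ∀ x y, 0 ≤ P x y)
    (hP₁ : ∀ x, μ x ≠ 0 → ∑ y, P x y = 1) (hνμ : ∀ x, μ x = 0 → ν x = 0) :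
    fDiv f (ν ᵥ* P) (μ ᵥ* P) ≤ fDiv f ν μ := by
  have jensen (y : β) : (μ ᵥ* P) y * f ((ν ᵥ* P) y / (μ ᵥ* P) y)
      ≤ ∑ x, μ x * P x y * f (ν x / μ x) := by
    have h := sum_mul_map_div_le (s := univ) hf (w := fun x => μ x * P x y)
      (u := fun x => ν x / μ x) (fun x _ => mul_nonneg (hμ x) (hP x y))
      (fun x _ => div_nonneg (hν x) (hμ x))
    have numerator (x : α) : μ x * P x y * (ν x / μ x) = ν x * P x y := by
      rw [mul_right_comm, mul_div_cancel_of_imp' (hνμ x)]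
    simp only [numerator] at h
    exact h
  calc fDiv f (ν ᵥ* P) (μ ᵥ* P) ≤ ∑ y, ∑ x, μ x * P x y * f (ν x / μ x) :=
        sum_le_sum fun y _ => jensen y
    _ = ∑ x, μ x * f (ν x / μ x) * ∑ y, P x y := by
        rw [sum_comm]
        simp only [mul_sum, mul_right_comm]
    _ = fDiv f ν μ := by
        refine sum_congr rfl fun x _ => ?_
        by_cases hx : μ x = 0
        · rw [hx, zero_mul, zero_mul]
        · rw [hP₁ x hx, mul_one]

theorem fDiv_nonneg {f : ℝ → ℝ} (hf : ConvexOn ℝ (Set.Ici 0) f) (hf₁ : f 1 = 0) {μ ν : α → ℝ}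
    (hμ : μ ∈ stdSimplex ℝ α) (hν : ν ∈ stdSimplex ℝ α) (hνμ : ∀ x, μ x = 0 → ν x = 0) :
    0 ≤ fDiv f ν μ := by
  have h := sum_mul_map_div_le (s := univ) hf (w := μ) (u := fun x => ν x / μ x)
    (fun x _ => hμ.1 x) (fun x _ => div_nonneg (hν.1 x) (hμ.1 x))
  simp only [fun x => mul_div_cancel_of_imp' (hνμ x), hν.2, hμ.2, div_one, hf₁, mul_zero] at h
  exact h

namespace Contracts

variable [Fintype β] {f : ℝ → ℝ} {P : Matrix α β ℝ} {ρ ρ' : ℝ} {μ : α → ℝ}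

theorem mono (h : Contracts f P ρ μ) (hf : ConvexOn ℝ (Set.Ici 0) f) (hf₁ : f 1 = 0)
    (hμ : μ ∈ stdSimplex ℝ α) (hρ : ρ ≤ ρ') : Contracts f P ρ' μ := fun ν hν hνμ =>
  (h ν hν hνμ).trans (mul_le_mul_of_nonneg_right hρ (fDiv_nonneg hf hf₁ hμ hν hνμ))

theorem mul {γ : Type*} [Fintype γ] {Q : Matrix β γ ℝ} (hP : Contracts f P ρ μ)
    (hQ : Contracts f Q ρ' (μ ᵥ* P)) (hμ : 0 ≤ μ) (hP₀ : ∀ x y, 0 ≤ P x y)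
    (hP₁ : ∀ x, ∑ y, P x y = 1) (hρ' : 0 ≤ ρ') : Contracts f (P * Q) (ρ' * ρ) μ := by
  intro ν hν hνμ
  rw [← Matrix.vecMul_vecMul, ← Matrix.vecMul_vecMul, mul_assoc]
  exact (hQ _ (vecMul_mem_stdSimplex hν hP₀ hP₁)
    fun y => vecMul_eq_zero_of_vecMul_eq_zero hμ hP₀ hνμ).trans
      (mul_le_mul_of_nonneg_left (hP ν hν hνμ) hρ')

end Contracts

end Kernel

section CondMean

variable {X Y Z : Type*} [Fintype X] [DecidableEq Y] [DecidableEq Z]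

/-- The conditional mean of `u` given `π` under the weights `μ`. It takes the junk value `0` on
fibres of weight `0`. -/
noncomputable def condMean (μ : X → ℝ) (π : X → Y) (u : X → ℝ) (x : X) : ℝ :=
  (∑ y with π y = π x, μ y * u y) / ∑ y with π y = π x, μ y

variable {μ : X → ℝ}

theorem fiber_weight_pos (hμ : 0 ≤ μ) (π : X → Y) {x : X} (hx : μ x ≠ 0) :
    0 < ∑ y with π y = π x, μ y :=
  sum_pos' (fun y _ => hμ y) ⟨x, by simp, (hμ x).lt_of_ne' hx⟩

theorem condMean_nonneg (hμ : 0 ≤ μ) (π : X → Y) {u : X → ℝ} (hu : 0 ≤ u) :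
    0 ≤ condMean μ π u := fun _ =>
  div_nonneg (sum_nonneg fun y _ => mul_nonneg (hμ y) (hu y)) (sum_nonneg fun y _ => hμ y)

theorem condMean_smul (π : X → Y) (c : ℝ) (u : X → ℝ) :
    condMean μ π (c • u) = c • condMean μ π u := by
  ext x
  simp only [condMean, Pi.smul_apply, smul_eq_mul, mul_left_comm, ← mul_sum, mul_div_assoc]

theorem condMean_expect {ι : Type*} (π : X → Y) (s : Finset ι) (u : ι → X → ℝ) :
    condMean μ π (𝔼 i ∈ s, u i) = 𝔼 i ∈ s, condMean μ π (u i) := by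
  ext x
  simp only [condMean, expect_apply, mul_expect, ← expect_sum_comm, expect_div]

theorem sum_condMean_mul (hμ : 0 ≤ μ) (π : X → Y) (u : X → ℝ) (v : Y → ℝ) :
    ∑ x, μ x * condMean μ π u x * v (π x) = ∑ x, μ x * u x * v (π x) := by
  have expand (x : X) : μ x * condMean μ π u x * v (π x)
      = ∑ y with π y = π x, μ x / (∑ z with π z = π y, μ z) * (μ y * u y * v (π y)) := by
    rw [condMean, sum_div, mul_sum, sum_mul]
    refine sum_congr rfl fun y hy => ?_
    rw [(mem_filter.1 hy).2]
    ring
  simp_rw [expand, sum_filter]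
  rw [sum_comm]
  refine sum_congr rfl fun y _ => ?_
  simp_rw [eq_comm (a := π y), ← sum_filter, ← sum_mul, ← sum_div]
  by_cases hy : μ y = 0
  · simp only [hy, zero_mul, mul_zero]
  · rw [div_self (fiber_weight_pos hμ π hy).ne', one_mul]

theorem sum_condMean (hμ : 0 ≤ μ) (π : X → Y) (u : X → ℝ) :
    ∑ x, μ x * condMean μ π u x = ∑ x, μ x * u x := by
  simpa only [mul_one] using sum_condMean_mul hμ π u fun _ => 1

theorem sum_map_condMean_le (hμ : 0 ≤ μ) {φ : ℝ → ℝ} (hφ : ConvexOn ℝ (Set.Ici 0) φ) (π : X → Y)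
    {u : X → ℝ} (hu : 0 ≤ u) : ∑ x, μ x * φ (condMean μ π u x) ≤ ∑ x, μ x * φ (u x) := by
  rw [← sum_condMean hμ π fun x => φ (u x)]
  refine sum_le_sum fun x _ => ?_
  by_cases hx : μ x = 0
  · simp only [hx, zero_mul, le_refl]
  · refine mul_le_mul_of_nonneg_left ?_ (hμ x)
    rw [condMean, condMean, le_div_iff₀' (fiber_weight_pos hμ π hx)]
    exact sum_mul_map_div_le hφ (fun y _ => hμ y) fun y _ => hu y

theorem condMean_condMean (hμ : 0 ≤ μ) (π : X → Y) (f : Y → Z) (u : X → ℝ) :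
    condMean μ (f ∘ π) (condMean μ π u) = condMean μ (f ∘ π) u := by
  ext x
  have h := sum_condMean_mul hμ π u fun y => if f y = f (π x) then 1 else 0
  simp only [mul_ite, mul_one, mul_zero, ← sum_filter] at h
  exact congrArg (· / _) h

theorem condMean_comp (hμ : 0 ≤ μ) (π : X → Y) (w : Y → ℝ) {x : X} (hx : μ x ≠ 0) :
    condMean μ π (w ∘ π) x = w (π x) := by
  rw [condMean, div_eq_iff (fiber_weight_pos hμ π hx).ne', mul_comm, sum_mul]
  refine sum_congr rfl fun y hy => ?_
  rw [Function.comp_apply, (mem_filter.1 hy).2]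

end CondMean

theorem convexOn_klFun : ConvexOn ℝ (Set.Ici 0) klFun := Real.convexOn_mul_log

theorem klFun_one : klFun 1 = 0 := by
  rw [klFun, Real.log_one, mul_zero]

theorem klFun_mul (c x : ℝ) : klFun (c * x) = c * klFun x + klFun c * x := by
  rcases eq_or_ne c 0 with rfl | hc
  · simp only [klFun, zero_mul, add_zero]
  rcases eq_or_ne x 0 with rfl | hx
  · simp only [klFun, zero_mul, mul_zero, add_zero]
  · rw [klFun, klFun, klFun, Real.log_mul hc hx]
    ring

theorem mul_klFun_div {a b : ℝ} (h : b = 0 → a = 0) :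
    b * klFun (a / b) = klFun a - a * Real.log b := by
  rcases eq_or_ne a 0 with rfl | ha
  · simp only [klFun, zero_div, zero_mul, mul_zero, sub_zero]
  · have hb : b ≠ 0 := fun hb => ha (h hb)
    rw [klFun, klFun, Real.log_div ha hb, ← mul_assoc, mul_div_cancel₀ _ hb, mul_sub]

theorem convexOn_chiSqFun : ConvexOn ℝ (Set.Ici 0) chiSqFun := by
  have h := (even_two.convexOn_pow (𝕜 := ℝ)).translate_left (-1)
  refine (h.subset (Set.subset_univ _) (convex_Ici 0)).congr fun x _ => ?_
  simp only [Function.comp_apply, chiSqFun, sub_eq_add_neg]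

theorem chiSqFun_one : chiSqFun 1 = 0 := by
  rw [chiSqFun, sub_self, zero_pow two_ne_zero]

section Entropy

variable {X : Type*} [Fintype X] {φ : ℝ → ℝ} {p u v : X → ℝ}

/-- The `φ`-entropy `E[φ(u)] - φ(E[u])` of a function under the weights `p`: the entropy of `u`
for `φ = klFun`, its variance for `φ = chiSqFun`. -/
noncomputable def phiEntropy (φ : ℝ → ℝ) (p u : X → ℝ) : ℝ :=
  ∑ x, p x * φ (u x) - φ (∑ x, p x * u x)

theorem phiEntropy_congr (h : ∀ x, p x ≠ 0 → u x = v x) :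
    phiEntropy φ p u = phiEntropy φ p v := by
  have eq (g : ℝ → ℝ) (x : X) : p x * g (u x) = p x * g (v x) := by
    by_cases hx : p x = 0
    · rw [hx, zero_mul, zero_mul]
    · rw [h x hx]
  simp only [phiEntropy, eq φ, show ∀ x, p x * u x = p x * v x from eq id]

theorem phiEntropy_nonneg (hφ : ConvexOn ℝ (Set.Ici 0) φ) (hp : p ∈ stdSimplex ℝ X)
    (hu : 0 ≤ u) : 0 ≤ phiEntropy φ p u :=
  sub_nonneg.2 (hφ.map_sum_le (fun x _ => hp.1 x) hp.2 fun x _ => hu x)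

theorem expect_sum_mul_map {ι : Type*} (s : Finset ι) (u : ι → X → ℝ) :
    𝔼 i ∈ s, ∑ x, p x * φ (u i x)
      = 𝔼 i ∈ s, phiEntropy φ p (u i) + 𝔼 i ∈ s, φ (∑ x, p x * u i x) := by
  simp only [← expect_add_distrib, phiEntropy, sub_add_cancel]

theorem phiEntropy_eq_zero (hp : p ∈ stdSimplex ℝ X) (hu : 0 ≤ u) (h : ∑ x, p x * u x = 0) :
    phiEntropy φ p u = 0 := by
  have h₀ := (sum_eq_zero_iff_of_nonneg fun x _ => mul_nonneg (hp.1 x) (hu x)).1 h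
  have hφ (x : X) : p x * φ (u x) = p x * φ 0 := by
    rcases mul_eq_zero.1 (h₀ x (mem_univ x)) with hx | hx
    · rw [hx, zero_mul, zero_mul]
    · rw [hx]
  simp only [phiEntropy, h, hφ, ← sum_mul, hp.2, one_mul, sub_self]

theorem phiEntropy_klFun_smul (c : ℝ) :
    phiEntropy klFun p (c • u) = c * phiEntropy klFun p u := by
  simp only [phiEntropy, Pi.smul_apply, smul_eq_mul, mul_left_comm (p _), ← mul_sum, klFun_mul,
    mul_add, sum_add_distrib]
  ring

/-- Gibbs' variational principle, with equality for `v = u`. -/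
theorem sum_mul_log_sub_le_phiEntropy (hp : 0 ≤ p) (hu : 0 ≤ u) (hv : 0 ≤ v)
    (huv : ∀ x, v x = 0 → u x = 0) :
    ∑ x, p x * (u x * Real.log (v x)) - (∑ x, p x * u x) * Real.log (∑ x, p x * v x)
      ≤ phiEntropy klFun p u := by
  have hsum : ∑ x, p x * v x = 0 → ∑ x, p x * u x = 0 := fun h => by
    refine sum_eq_zero fun x hx => ?_
    have h := (sum_eq_zero_iff_of_nonneg fun x _ => mul_nonneg (hp x) (hv x)).1 h x hx
    rcases mul_eq_zero.1 h with h | h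
    · rw [h, zero_mul]
    · rw [huv x h, mul_zero]
  have logSum := sum_mul_map_div_le (s := univ) convexOn_klFun (w := fun x => p x * v x)
    (u := fun x => u x / v x) (fun x _ => mul_nonneg (hp x) (hv x))
    (fun x _ => div_nonneg (hu x) (hv x))
  simp only [mul_assoc, fun x => mul_div_cancel_of_imp' (huv x), fun x => mul_klFun_div (huv x),
    mul_klFun_div hsum, mul_sub, sum_sub_distrib] at logSum
  rw [phiEntropy]
  linarith

theorem convexOn_phiEntropy_klFun (hp : 0 ≤ p) :
    ConvexOn ℝ (Set.Ici 0) (phiEntropy klFun p) := by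
  refine convexOn_iff_forall_pos.2 ⟨convex_Ici 0, fun u hu v hv a b ha hb _ => ?_⟩
  have hu₀ : 0 ≤ a • u := smul_nonneg ha.le hu
  have hv₀ : 0 ≤ b • v := smul_nonneg hb.le hv
  have split {x : X} (hx : (a • u + b • v) x = 0) : u x = 0 ∧ v x = 0 := by
    have h := (add_eq_zero_iff_of_nonneg (hu₀ x) (hv₀ x)).1 hx
    exact ⟨(smul_eq_zero_iff_right ha.ne').1 h.1, (smul_eq_zero_iff_right hb.ne').1 h.2⟩
  have hu' := sum_mul_log_sub_le_phiEntropy hp hu (add_nonneg hu₀ hv₀) fun x hx => (split hx).1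
  have hv' := sum_mul_log_sub_le_phiEntropy hp hv (add_nonneg hu₀ hv₀) fun x hx => (split hx).2
  refine le_trans (le_of_eq ?_)
    (add_le_add (mul_le_mul_of_nonneg_left hu' ha.le) (mul_le_mul_of_nonneg_left hv' hb.le))
  set w := a • u + b • v with hw
  have mix (g : X → ℝ) :
      ∑ x, p x * (w x * g x) = a * ∑ x, p x * (u x * g x) + b * ∑ x, p x * (v x * g x) := by
    simp only [mul_sum, ← sum_add_distrib, hw, Pi.add_apply, Pi.smul_apply, smul_eq_mul]
    exact sum_congr rfl fun x _ => by ring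
  have mean := mix 1
  simp only [Pi.one_apply, mul_one] at mean
  rw [phiEntropy]
  simp only [klFun]
  rw [mix fun x => Real.log (w x)]
  linear_combination -Real.log (∑ x, p x * w x) * mean

theorem phiEntropy_chiSqFun (hp : ∑ x, p x = 1) :
    phiEntropy chiSqFun p u = ∑ x, p x * (u x - ∑ y, p y * u y) ^ 2 := by
  set m := ∑ y, p y * u y with hm
  have expand (x : X) : p x * (u x - m) ^ 2
      = p x * (u x - 1) ^ 2 - 2 * (m - 1) * (p x * u x) + (m ^ 2 - 1) * p x := by ring
  simp only [phiEntropy, chiSqFun, expand, sum_add_distrib, sum_sub_distrib, ← mul_sum, hp, ← hm]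
  ring

theorem phiEntropy_chiSqFun_smul (hp : ∑ x, p x = 1) (c : ℝ) :
    phiEntropy chiSqFun p (c • u) = c ^ 2 * phiEntropy chiSqFun p u := by
  simp only [phiEntropy_chiSqFun hp, Pi.smul_apply, smul_eq_mul, mul_left_comm (p _), ← mul_sum,
    ← mul_sub, mul_pow]

theorem convexOn_phiEntropy_chiSqFun (hp : p ∈ stdSimplex ℝ X) :
    ConvexOn ℝ (Set.Ici 0) (phiEntropy chiSqFun p) := by
  refine ⟨convex_Ici 0, fun u _ v _ a b ha hb hab => ?_⟩
  simp only [phiEntropy_chiSqFun hp.2, smul_eq_mul, mul_sum, ← sum_add_distrib]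
  refine sum_le_sum fun x _ => ?_
  have sq := mul_le_mul_of_nonneg_left ((even_two.convexOn_pow (𝕜 := ℝ)).2 (Set.mem_univ
    (u x - ∑ y, p y * u y)) (Set.mem_univ (v x - ∑ y, p y * v y)) ha hb hab) (hp.1 x)
  refine le_trans (le_of_eq ?_) (sq.trans (le_of_eq ?_))
  · simp only [Pi.add_apply, Pi.smul_apply, smul_eq_mul, mul_add, sum_add_distrib,
      mul_left_comm (p _), ← mul_sum]
    ring
  · simp only [smul_eq_mul]
    ring

section CondMean

variable {Y Z : Type*} [DecidableEq Y] [DecidableEq Z]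

theorem phiEntropy_condMean_comp_le (hφ : ConvexOn ℝ (Set.Ici 0) φ) (hp : 0 ≤ p) (π : X → Y)
    (f : Y → Z) (hu : 0 ≤ u) :
    phiEntropy φ p (condMean p (f ∘ π) u) ≤ phiEntropy φ p (condMean p π u) := by
  rw [phiEntropy, phiEntropy, sum_condMean hp, sum_condMean hp, ← condMean_condMean hp π f]
  exact sub_le_sub_right (sum_map_condMean_le hp hφ _ (condMean_nonneg hp π hu)) _

end CondMean

end Entropy

section PairAverage

variable {ι : Type*} [DecidableEq ι] {s : Finset ι}

theorem expect_expect_erase (s : Finset ι) (F : ι → ι → ℝ) :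
    𝔼 y ∈ s, 𝔼 z ∈ s.erase y, F y z
      = (∑ y ∈ s, ∑ z ∈ s.erase y, F y z) / ((#s : ℝ) - 1) / #s := by
  rw [expect_eq_sum_div_card, sum_div _ _ ((#s : ℝ) - 1)]
  congr 1
  refine sum_congr rfl fun y hy => ?_
  rw [expect_eq_sum_div_card, cast_card_erase_of_mem hy]

theorem expect_expect_erase_swap (s : Finset ι) (F : ι → ι → ℝ) :
    𝔼 y ∈ s, 𝔼 z ∈ s.erase y, F y z = 𝔼 y ∈ s, 𝔼 z ∈ s.erase y, F z y := by
  rw [expect_expect_erase, expect_expect_erase, sum_comm' (t' := s) (s' := fun z => s.erase z)]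
  intro y z
  simp only [mem_erase]
  tauto

theorem expect_expect_erase_const (hs : 1 < #s) (F : ι → ℝ) :
    𝔼 y ∈ s, 𝔼 _z ∈ s.erase y, F y = 𝔼 y ∈ s, F y :=
  expect_congr rfl fun y hy => expect_const (card_pos.1 (by rw [card_erase_of_mem hy]; omega)) _

theorem expect_sq_add_pred_card_mul (hs : 1 < #s) (h : ι → ℝ) :
    𝔼 y ∈ s, h y ^ 2 + ((#s : ℝ) - 1) * 𝔼 y ∈ s, 𝔼 z ∈ s.erase y, h y * h z
      = #s * (𝔼 y ∈ s, h y) ^ 2 := by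
  have hs' : (1 : ℝ) < #s := by exact_mod_cast hs
  have hs₀ : (#s : ℝ) ≠ 0 := by positivity
  have hs₁ : (#s : ℝ) - 1 ≠ 0 := by linarith
  have total : (∑ y ∈ s, h y) ^ 2 = ∑ y ∈ s, h y ^ 2 + ∑ y ∈ s, ∑ z ∈ s.erase y, h y * h z := by
    rw [sq, sum_mul_sum, ← sum_add_distrib]
    refine sum_congr rfl fun y hy => ?_
    rw [← add_sum_erase s _ hy, sq]
  rw [expect_expect_erase, expect_eq_sum_div_card, expect_eq_sum_div_card, div_pow, total]
  field_simp

theorem expect_expect_erase_mul_le (hs : 1 < #s) (h : ι → ℝ) :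
    𝔼 y ∈ s, 𝔼 z ∈ s.erase y, h y * h z ≤ (𝔼 y ∈ s, h y) ^ 2 := by
  have hs' : (0 : ℝ) < (#s : ℝ) - 1 := by
    rw [sub_pos]
    exact_mod_cast hs
  have jensen : (𝔼 y ∈ s, h y) ^ 2 ≤ 𝔼 y ∈ s, h y ^ 2 := by
    have hcs := expect_mul_sq_le_sq_mul_sq s h 1
    simpa only [Pi.one_apply, one_pow, mul_one, expect_const (card_pos.1 (by omega : 0 < #s))]
      using hcs
  refine le_of_mul_le_mul_left ?_ hs'
  linarith [expect_sq_add_pred_card_mul hs h]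

/-- A convexity property of `φ` along the three levels of averages of a symmetric function of two
points of a finite set, where `γ` weights a level by the number of points that remain: it is what
makes the down operators contract on the complete complex. -/
def PairConvex (φ : ℝ → ℝ) (γ : ℕ → ℝ) (ι : Type*) [DecidableEq ι] : Prop :=
  ∀ (s : Finset ι) (r : ℕ), #s = r + 2 → ∀ w : ι → ι → ℝ, (∀ y z, w y z = w z y) →
    (∀ y z, 0 ≤ w y z) →
      2 * γ (r + 1) * 𝔼 y ∈ s, φ (𝔼 z ∈ s.erase y, w y z)
        ≤ γ r * (𝔼 y ∈ s, 𝔼 z ∈ s.erase y, φ (w y z))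
          + γ (r + 2) * φ (𝔼 y ∈ s, 𝔼 z ∈ s.erase y, w y z)

theorem mul_log_add_mul_log_le {w a b c : ℝ} (hw : 0 ≤ w) (ha : 0 ≤ a) (hb : 0 ≤ b) (hc : 0 ≤ c)
    (hwa : a = 0 → w = 0) (hwb : b = 0 → w = 0) (hwc : c = 0 → w = 0) :
    w * Real.log a + w * Real.log b - w * Real.log c + w - a * b / c ≤ klFun w := by
  rcases hw.eq_or_lt with rfl | hw
  · have : 0 ≤ a * b / c := by positivity
    simpa only [klFun, zero_mul, add_zero, sub_self, zero_sub, neg_nonpos] using this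
  have ha : 0 < a := ha.lt_of_ne' fun h => hw.ne' (hwa h)
  have hb : 0 < b := hb.lt_of_ne' fun h => hw.ne' (hwb h)
  have hc : 0 < c := hc.lt_of_ne' fun h => hw.ne' (hwc h)
  have tangent := mul_le_mul_of_nonneg_left
    (Real.log_le_sub_one_of_pos (x := a * b / c / w) (by positivity)) hw.le
  rw [Real.log_div (by positivity) hw.ne', Real.log_div (by positivity) hc.ne',
    Real.log_mul ha.ne' hb.ne', mul_sub_one, mul_div_cancel₀ _ hw.ne'] at tangent
  rw [klFun]
  linarith

theorem pairConvex_klFun : PairConvex klFun (fun _ => 1) ι := by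
  intro s r hs w hw hw₀
  have hs₁ : 1 < #s := by omega
  set h : ι → ℝ := fun y => 𝔼 z ∈ s.erase y, w y z with hh
  set c : ℝ := 𝔼 y ∈ s, h y with hc
  have h₀ (y : ι) : 0 ≤ h y := expect_nonneg fun z _ => hw₀ y z
  have c₀ : 0 ≤ c := expect_nonneg fun y _ => h₀ y
  have h_zero {y z : ι} (hz : z ∈ s.erase y) (e : h y = 0) : w y z = 0 :=
    (expect_eq_zero_iff_of_nonneg fun z _ => hw₀ y z).1 e z hz
  have c_zero {y z : ι} (hy : y ∈ s) (hz : z ∈ s.erase y) (e : c = 0) : w y z = 0 :=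
    h_zero hz ((expect_eq_zero_iff_of_nonneg fun y _ => h₀ y).1 e y hy)
  have pointwise : 𝔼 y ∈ s, 𝔼 z ∈ s.erase y,
      (w y z * Real.log (h y) + w y z * Real.log (h z) - w y z * Real.log c + w y z
        - h y * h z / c) ≤ 𝔼 y ∈ s, 𝔼 z ∈ s.erase y, klFun (w y z) := by
    refine expect_le_expect fun y hy => expect_le_expect fun z hz => ?_
    have hz' : y ∈ s.erase z := by
      rw [mem_erase] at hz ⊢
      exact ⟨hz.1.symm, hy⟩
    exact mul_log_add_mul_log_le (hw₀ y z) (h₀ y) (h₀ z) c₀ (h_zero hz)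
      (fun e => (hw y z).trans (h_zero hz' e)) (c_zero hy hz)
  have swap : 𝔼 y ∈ s, 𝔼 z ∈ s.erase y, w y z * Real.log (h z) = 𝔼 y ∈ s, klFun (h y) := by
    rw [expect_expect_erase_swap]
    simp only [fun y z => hw z y, ← expect_mul, klFun, hh]
  have mean_mul : (𝔼 y ∈ s, 𝔼 z ∈ s.erase y, h y * h z) / c ≤ c := by
    rcases c₀.eq_or_lt with e | e
    · rw [← e, div_zero]
    · rw [div_le_iff₀ e, ← sq]
      exact expect_expect_erase_mul_le hs₁ h
  simp only [expect_add_distrib, expect_sub_distrib, ← expect_mul, ← expect_div, swap] at pointwise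
  rw [← hc] at pointwise
  simp only [klFun] at pointwise ⊢
  linarith

theorem expect_sq_expect_erase_le {r : ℕ} (hs : #s = r + 2) {a : ι → ι → ℝ}
    (ha : ∀ y z, a y z = a z y) (ha₀ : 𝔼 y ∈ s, 𝔼 z ∈ s.erase y, a y z = 0) :
    2 * ((r : ℝ) + 1) * 𝔼 y ∈ s, (𝔼 z ∈ s.erase y, a y z) ^ 2
      ≤ r * 𝔼 y ∈ s, 𝔼 z ∈ s.erase y, a y z ^ 2 := by
  rcases r.eq_zero_or_pos with rfl | hr
  · obtain ⟨x, y, hxy, rfl⟩ := card_eq_two.1 hs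
    have hx : ({x, y} : Finset ι).erase x = {y} := erase_insert (notMem_singleton.2 hxy)
    have hy : ({x, y} : Finset ι).erase y = {x} := by
      rw [pair_comm, erase_insert (notMem_singleton.2 hxy.symm)]
    simp only [expect_eq_sum_div_card, sum_pair hxy, hx, hy, sum_singleton, card_singleton,
      card_pair hxy, ha y x, Nat.cast_one, div_one] at ha₀ ⊢
    have hxy₀ : a x y = 0 := by linarith
    simp only [hxy₀, Nat.cast_zero, zero_mul]
    norm_num
  set b : ι → ℝ := fun y => 𝔼 z ∈ s.erase y, a y z with hb
  have hs₁ : 1 < #s := by omega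
  have cross : 𝔼 y ∈ s, 𝔼 z ∈ s.erase y, a y z * b y = 𝔼 y ∈ s, b y ^ 2 := by
    simp only [← expect_mul, sq, hb]
  have cross' : 𝔼 y ∈ s, 𝔼 z ∈ s.erase y, a y z * b z = 𝔼 y ∈ s, b y ^ 2 := by
    rw [expect_expect_erase_swap, ← cross]
    simp only [fun y z => ha z y]
  have diag := expect_expect_erase_const hs₁ fun y => b y ^ 2
  have diag' : 𝔼 y ∈ s, 𝔼 z ∈ s.erase y, b z ^ 2 = 𝔼 y ∈ s, b y ^ 2 := by
    rw [expect_expect_erase_swap, diag]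
  have offDiag := expect_sq_add_pred_card_mul hs₁ b
  rw [ha₀, hs] at offDiag
  simp only [← mul_expect] at offDiag
  push_cast at offDiag
  -- `a y z - (r + 1) / r * (b y + b z)` is the component of `a` orthogonal to all functions
  -- `(y, z) ↦ f y + f z`.
  have square : 0 ≤ 𝔼 y ∈ s, 𝔼 z ∈ s.erase y, (r * a y z - (r + 1) * (b y + b z)) ^ 2 :=
    expect_nonneg fun y _ => expect_nonneg fun z _ => sq_nonneg _
  have expand (y z : ι) : ((r : ℝ) * a y z - (r + 1) * (b y + b z)) ^ 2
      = r ^ 2 * a y z ^ 2 - 2 * r * (r + 1) * (a y z * b y) - 2 * r * (r + 1) * (a y z * b z)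
        + (r + 1) ^ 2 * b y ^ 2 + (r + 1) ^ 2 * b z ^ 2 + 2 * (r + 1) ^ 2 * (b y * b z) := by ring
  simp only [expand, expect_add_distrib, expect_sub_distrib, ← mul_expect] at square
  rw [cross, cross', diag, diag'] at square
  refine le_of_mul_le_mul_left ?_ (Nat.cast_pos.2 hr : (0 : ℝ) < r)
  linear_combination square + 2 * ((r : ℝ) + 1) * offDiag

theorem pairConvex_chiSqFun : PairConvex chiSqFun (fun r => r) ι := by
  intro s r hs w hw _
  set c : ℝ := 𝔼 y ∈ s, 𝔼 z ∈ s.erase y, w y z with hc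
  have hs₁ : 1 < #s := by omega
  have hs₀ : s.Nonempty := card_pos.1 (by omega)
  have ne_erase {y : ι} (hy : y ∈ s) : (s.erase y).Nonempty :=
    card_pos.1 (by rw [card_erase_of_mem hy]; omega)
  have mean {y : ι} (hy : y ∈ s) :
      𝔼 z ∈ s.erase y, (w y z - c) = 𝔼 z ∈ s.erase y, w y z - c := by
    rw [expect_sub_distrib, expect_const (ne_erase hy)]
  have sq_split (x : ℝ) : chiSqFun x = (x - c) ^ 2 + 2 * (c - 1) * (x - c) + (c - 1) ^ 2 := by
    rw [chiSqFun]
    ring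
  have mean_h : 𝔼 y ∈ s, (𝔼 z ∈ s.erase y, w y z - c) = 0 := by
    rw [expect_sub_distrib, ← hc, expect_const hs₀, sub_self]
  have mean_w : 𝔼 y ∈ s, 𝔼 z ∈ s.erase y, (w y z - c) = 0 := by
    rw [expect_congr rfl fun y hy => mean hy, mean_h]
  have hw_sq := expect_sq_expect_erase_le hs (a := fun y z => w y z - c)
    (fun y z => by rw [hw]) mean_w
  rw [expect_congr rfl fun y hy => by rw [mean hy]] at hw_sq
  have level₁ : 𝔼 y ∈ s, chiSqFun (𝔼 z ∈ s.erase y, w y z)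
      = 𝔼 y ∈ s, (𝔼 z ∈ s.erase y, w y z - c) ^ 2 + (c - 1) ^ 2 := by
    simp only [sq_split, expect_add_distrib, ← mul_expect, mean_h, expect_const hs₀, mul_zero,
      add_zero]
  have level₂ : 𝔼 y ∈ s, 𝔼 z ∈ s.erase y, chiSqFun (w y z)
      = 𝔼 y ∈ s, 𝔼 z ∈ s.erase y, (w y z - c) ^ 2 + (c - 1) ^ 2 := by
    simp only [sq_split, expect_add_distrib, ← mul_expect, mean_w,
      expect_expect_erase_const hs₁ fun _ => (c - 1) ^ 2, expect_const hs₀, mul_zero, add_zero]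
  rw [level₁, level₂, chiSqFun]
  push_cast
  linear_combination hw_sq

end PairAverage

theorem map_expect_le {E α : Type*} [AddCommGroup E] [Module ℝ E] [Module ℚ≥0 E] {K : Set E}
    {f : E → ℝ} (hf : ConvexOn ℝ K f) {s : Finset α} (hs : s.Nonempty) {u : α → E}
    (hu : ∀ x ∈ s, u x ∈ K) : f (𝔼 x ∈ s, u x) ≤ 𝔼 x ∈ s, f (u x) := by
  have hw : ∑ _x ∈ s, ((#s : ℚ≥0)⁻¹ : ℚ≥0) = 1 := by
    rw [sum_const, nsmul_eq_mul, mul_inv_cancel₀ (Nat.cast_ne_zero.2 hs.card_ne_zero)]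
  have h := hf.map_sum_le (t := s) (w := fun _ => (((#s : ℚ≥0)⁻¹ : ℚ≥0) : ℝ)) (p := u)
    (fun _ _ => NNRat.cast_nonneg _) (by exact_mod_cast hw) hu
  simpa only [expect, NNRat.cast_smul_eq_nnqsmul, ← smul_sum] using h

section DoubleCounting

variable {ι : Type*} [DecidableEq ι]

theorem sum_powersetCard_succ_erase (R : Finset ι) (j : ℕ) (G : ι → Finset ι → ℝ) :
    ∑ S ∈ R.powersetCard (j + 1), ∑ i ∈ S, G i (S.erase i)
      = ∑ T ∈ R.powersetCard j, ∑ i ∈ R \ T, G i T := by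
  rw [sum_sigma', sum_sigma']
  refine sum_bij' (fun a _ => ⟨a.1.erase a.2, a.2⟩) (fun a _ => ⟨insert a.2 a.1, a.2⟩)
    ?_ ?_ ?_ ?_ fun _ _ => rfl
  · rintro ⟨S, i⟩ h
    simp only [mem_sigma, mem_powersetCard, mem_sdiff] at h ⊢
    exact ⟨⟨(erase_subset i S).trans h.1.1, by rw [card_erase_of_mem h.2, h.1.2]; rfl⟩,
      h.1.1 h.2, notMem_erase i S⟩
  · rintro ⟨T, i⟩ h
    simp only [mem_sigma, mem_powersetCard, mem_sdiff] at h ⊢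
    exact ⟨⟨insert_subset h.2.1 h.1.1, by rw [card_insert_of_notMem h.2.2, h.1.2]⟩,
      mem_insert_self i T⟩
  · rintro ⟨S, i⟩ h
    simp only [insert_erase (mem_sigma.1 h).2]
  · rintro ⟨T, i⟩ h
    simp only [erase_insert (mem_sdiff.1 (mem_sigma.1 h).2).2]

theorem expect_powersetCard_succ_erase (R : Finset ι) (j : ℕ) (G : ι → Finset ι → ℝ) :
    𝔼 S ∈ R.powersetCard (j + 1), 𝔼 i ∈ S, G i (S.erase i)
      = 𝔼 T ∈ R.powersetCard j, 𝔼 i ∈ R \ T, G i T := by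
  have hS : ∀ S ∈ R.powersetCard (j + 1),
      𝔼 i ∈ S, G i (S.erase i) = (∑ i ∈ S, G i (S.erase i)) / (j + 1 : ℕ) := fun S hS => by
    rw [expect_eq_sum_div_card, (mem_powersetCard.1 hS).2]
  have hT : ∀ T ∈ R.powersetCard j,
      𝔼 i ∈ R \ T, G i T = (∑ i ∈ R \ T, G i T) / (#R - j : ℕ) := fun T hT => by
    rw [expect_eq_sum_div_card, card_sdiff_of_subset (mem_powersetCard.1 hT).1,
      (mem_powersetCard.1 hT).2]
  rw [expect_congr rfl hS, expect_congr rfl hT, ← expect_div, ← expect_div,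
    expect_eq_sum_div_card, expect_eq_sum_div_card, sum_powersetCard_succ_erase, div_div, div_div,
    card_powersetCard, card_powersetCard]
  congr 1
  exact_mod_cast Nat.choose_succ_right_eq _ _

theorem expect_expect_map_erase {R : Finset ι} {j : ℕ} (hj : j < #R) (F : Finset ι → ℝ) :
    𝔼 S ∈ R.powersetCard (j + 1), 𝔼 i ∈ S, F (S.erase i) = 𝔼 T ∈ R.powersetCard j, F T := by
  rw [expect_powersetCard_succ_erase R j fun _ T => F T]
  refine expect_congr rfl fun T hT => expect_const (card_pos.1 ?_) _
  rw [mem_powersetCard] at hT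
  rw [card_sdiff_of_subset hT.1, hT.2]
  omega

theorem expect_powersetCard_of_card_eq_succ {A : Finset ι} {j : ℕ} (hA : #A = j + 1)
    (F : Finset ι → ℝ) : 𝔼 T ∈ A.powersetCard j, F T = 𝔼 i ∈ A, F (A.erase i) := by
  rw [← expect_expect_map_erase (by omega), ← hA, powersetCard_self, expect_singleton]

end DoubleCounting

section Johnson

variable {ι : Type*} [Fintype ι] [DecidableEq ι]

/-- The average of `f` over the sets obtained from `T` by adding one element. -/
noncomputable def upAvg (f : Finset ι → ℝ) (T : Finset ι) : ℝ :=
  𝔼 i ∈ Tᶜ, f (insert i T)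

theorem upAvg_nonneg {f : Finset ι → ℝ} (hf : 0 ≤ f) : 0 ≤ upAvg f :=
  fun _ => expect_nonneg fun _ _ => hf _

theorem upAvg_erase_univ (f : Finset ι → ℝ) (i : ι) :
    upAvg f (univ.erase i) = f univ := by
  rw [upAvg, compl_erase, compl_univ, insert_empty_eq, expect_singleton,
    insert_erase (mem_univ i)]

theorem expect_upAvg (j : ℕ) (f : Finset ι → ℝ) :
    𝔼 T ∈ powersetCard j univ, upAvg f T = 𝔼 S ∈ powersetCard (j + 1) univ, f S := by
  simp only [upAvg, compl_eq_univ_sdiff]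
  rw [← expect_powersetCard_succ_erase univ j fun i T => f (insert i T)]
  refine expect_congr rfl fun S hS => ?_
  have hne : S.Nonempty := card_pos.1 (by rw [mem_powersetCard_univ.1 hS]; exact j.succ_pos)
  rw [expect_congr rfl fun i hi => by rw [insert_erase hi], expect_const hne]

/-- `ρ`-contraction in `φ`-divergence of the down operator from the `(j + 1)`-element to the
`j`-element subsets of `ι`, with respect to the uniform distribution. It is stated for the density
`m` of a distribution on the `(j + 1)`-element subsets, whose image has the density `upAvg m`. -/
def JohnsonContracts (φ : ℝ → ℝ) (ι : Type*) [Fintype ι] [DecidableEq ι] (j : ℕ) (ρ : ℝ) : Prop :=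
  ∀ m : Finset ι → ℝ, 0 ≤ m → 𝔼 S ∈ powersetCard (j + 1) univ, m S = 1 →
    𝔼 T ∈ powersetCard j univ, φ (upAvg m T) ≤ ρ * 𝔼 S ∈ powersetCard (j + 1) univ, φ (m S)

variable {φ : ℝ → ℝ}

theorem JohnsonContracts.mono {j : ℕ} {ρ ρ' : ℝ} (h : JohnsonContracts φ ι j ρ)
    (hφ : ConvexOn ℝ (Set.Ici 0) φ) (hφ₁ : φ 1 = 0) (hρ : ρ ≤ ρ') :
    JohnsonContracts φ ι j ρ' := by
  refine fun m hm hm₁ => (h m hm hm₁).trans (mul_le_mul_of_nonneg_right hρ ?_)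
  have hne : (powersetCard (j + 1) (univ : Finset ι)).Nonempty := by
    by_contra hne
    rw [not_nonempty_iff_eq_empty.1 hne, expect_empty] at hm₁
    exact zero_ne_one hm₁
  have jensen := map_expect_le hφ hne fun S _ => hm S
  rwa [hm₁, hφ₁] at jensen

variable {γ : ℕ → ℝ}

theorem PairConvex.upAvg_le (hφ : PairConvex φ γ ι) {m : Finset ι → ℝ} (hm : 0 ≤ m) {r : ℕ}
    {T : Finset ι} (hT : #Tᶜ = r + 2) :
    2 * γ (r + 1) * upAvg (fun S => φ (upAvg m S)) T
      ≤ γ r * upAvg (upAvg fun S => φ (m S)) T + γ (r + 2) * φ (upAvg (upAvg m) T) := by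
  simpa only [upAvg, compl_insert] using hφ Tᶜ r hT (fun y z => m (insert z (insert y T)))
    (fun y z => by rw [insert_comm]) fun _ _ => hm _

theorem PairConvex.expect_le (hφ : PairConvex φ γ ι) {m : Finset ι → ℝ} (hm : 0 ≤ m) {j r : ℕ}
    (hr : j + r + 2 = Fintype.card ι) :
    2 * γ (r + 1) * 𝔼 S ∈ powersetCard (j + 1) univ, φ (upAvg m S)
      ≤ γ r * 𝔼 S ∈ powersetCard (j + 2) univ, φ (m S)
        + γ (r + 2) * 𝔼 T ∈ powersetCard j univ, φ (upAvg (upAvg m) T) := by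
  rw [← expect_upAvg j, ← expect_upAvg (j + 1), ← expect_upAvg j]
  simp only [mul_expect, ← expect_add_distrib]
  refine expect_le_expect fun T hT => hφ.upAvg_le hm ?_
  rw [card_compl, mem_powersetCard_univ.1 hT]
  omega

theorem PairConvex.expect_upAvg_le (hφ : PairConvex φ γ ι) (hφ₁ : φ 1 = 0) {m : Finset ι → ℝ}
    (hm : 0 ≤ m) {j r : ℕ} (hr : j + 1 + r = Fintype.card ι)
    (hm₁ : 𝔼 S ∈ powersetCard (j + 1) univ, m S = 1) :
    γ (r + 1) * (j + 1) * 𝔼 T ∈ powersetCard j univ, φ (upAvg m T)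
      ≤ j * γ r * 𝔼 S ∈ powersetCard (j + 1) univ, φ (m S) := by
  induction j generalizing m r with
  | zero =>
    rw [← expect_upAvg] at hm₁
    simp only [powersetCard_zero, expect_singleton] at hm₁ ⊢
    rw [hm₁, hφ₁, Nat.cast_zero, zero_mul, zero_mul, mul_zero]
  | succ j ih =>
    have below := ih (upAvg_nonneg hm) (r := r + 1) (by omega)
      ((expect_upAvg _ m).trans hm₁)
    have convex := mul_le_mul_of_nonneg_left (hφ.expect_le hm (j := j) (r := r) (by omega))
      (by positivity : (0 : ℝ) ≤ j + 1)
    push_cast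
    linarith

theorem johnsonContracts_klFun {j : ℕ} (hj : j < Fintype.card ι) :
    JohnsonContracts klFun ι j (1 - 1 / (j + 1 : ℕ)) := by
  intro m hm hm₁
  have h := pairConvex_klFun.expect_upAvg_le klFun_one hm (r := Fintype.card ι - (j + 1))
    (by omega) hm₁
  rw [one_mul, mul_one] at h
  refine le_of_mul_le_mul_left (h.trans_eq ?_) (by positivity : (0 : ℝ) < j + 1)
  push_cast
  field_simp
  ring

theorem johnsonContracts_chiSqFun {j : ℕ} (hj : j < Fintype.card ι) :
    JohnsonContracts chiSqFun ι j
      (1 - 1 / ((j + 1 : ℕ) * ((Fintype.card ι - (j + 1 : ℕ) + 1) / Fintype.card ι))) := by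
  intro m hm hm₁
  obtain ⟨r, hr⟩ := Nat.exists_eq_add_of_le (Nat.succ_le_of_lt hj)
  have h := pairConvex_chiSqFun.expect_upAvg_le chiSqFun_one hm hr.symm hm₁
  rw [hr]
  refine le_of_mul_le_mul_left (h.trans_eq ?_) (by positivity : (0 : ℝ) < (r + 1 : ℕ) * (j + 1))
  push_cast
  field_simp
  ring_nf

end Johnson

section Down

theorem sum_slice {Ω : Type*} [Fintype Ω] (k : ℕ) (F : Finset Ω → ℝ) :
    ∑ A : Slice Ω k, F A.1 = ∑ A ∈ powersetCard k univ, F A :=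
  (sum_subtype _ (fun _ => mem_powersetCard_univ) F).symm

variable {Ω : Type*} [DecidableEq Ω]

theorem down_nonneg (k ℓ : ℕ) (A : Slice Ω k) (B : Slice Ω ℓ) : 0 ≤ down Ω k ℓ A B := by
  unfold down
  split_ifs
  · positivity
  · rfl

theorem down_apply (k ℓ : ℕ) (A : Slice Ω k) (B : Slice Ω ℓ) :
    down Ω k ℓ A B = 𝔼 T ∈ A.1.powersetCard ℓ, if T = B.1 then 1 else 0 := by
  simp only [expect_eq_sum_div_card, sum_ite_eq', mem_powersetCard, B.2, and_true,
    card_powersetCard, A.2, down, ite_div, zero_div]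

theorem down_self (k : ℕ) : down Ω k k = 1 := by
  ext A B
  have hA : A.1.powersetCard k = {A.1} := by
    have h := powersetCard_self A.1
    rwa [A.2] at h
  simp only [down_apply, hA, expect_singleton, Matrix.one_apply, Subtype.ext_iff]

variable [Fintype Ω]

theorem down_mulVec (k ℓ : ℕ) (F : Finset Ω → ℝ) (A : Slice Ω k) :
    (down Ω k ℓ *ᵥ fun B => F B.1) A = 𝔼 B ∈ A.1.powersetCard ℓ, F B := by
  have expand : (down Ω k ℓ *ᵥ fun B => F B.1) A
      = ∑ B : Slice Ω ℓ, if B.1 ⊆ A.1 then F B.1 / (k.choose ℓ : ℝ) else 0 :=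
    sum_congr rfl fun B _ => by
      simp only [down, ite_mul, zero_mul, one_div_mul_eq_div]
  rw [expand, sum_slice ℓ fun B => if B ⊆ A.1 then F B / (k.choose ℓ : ℝ) else 0, ← sum_filter,
    ← sum_div, expect_eq_sum_div_card, card_powersetCard, A.2]
  congr 2
  ext B
  simp only [mem_filter, mem_powersetCard, subset_univ, true_and, and_comm]

theorem sum_down {k ℓ : ℕ} (h : ℓ ≤ k) (A : Slice Ω k) : ∑ B, down Ω k ℓ A B = 1 := by
  have hne : (A.1.powersetCard ℓ).Nonempty := powersetCard_nonempty.2 (h.trans_eq A.2.symm)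
  simpa only [Matrix.mulVec, dotProduct, mul_one, expect_const hne]
    using down_mulVec k ℓ (fun _ => 1) A

theorem down_mul_down_succ {k ℓ : ℕ} (h : ℓ < k) :
    down Ω k (ℓ + 1) * down Ω (ℓ + 1) ℓ = down Ω k ℓ := by
  ext A B
  let F : Finset Ω → ℝ := fun T => if T = B.1 then 1 else 0
  calc (down Ω k (ℓ + 1) * down Ω (ℓ + 1) ℓ) A B
      = (down Ω k (ℓ + 1) *ᵥ fun S => 𝔼 T ∈ S.1.powersetCard ℓ, F T) A :=
        sum_congr rfl fun S _ => congrArg _ (down_apply (ℓ + 1) ℓ S B)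
    _ = 𝔼 S ∈ A.1.powersetCard (ℓ + 1), 𝔼 T ∈ S.powersetCard ℓ, F T :=
        down_mulVec k (ℓ + 1) (fun S => 𝔼 T ∈ S.powersetCard ℓ, F T) A
    _ = 𝔼 S ∈ A.1.powersetCard (ℓ + 1), 𝔼 i ∈ S, F (S.erase i) :=
        expect_congr rfl fun S hS =>
          expect_powersetCard_of_card_eq_succ (mem_powersetCard.1 hS).2 F
    _ = 𝔼 T ∈ A.1.powersetCard ℓ, F T := expect_expect_map_erase (h.trans_eq A.2.symm) F
    _ = down Ω k ℓ A B := (down_apply k ℓ A B).symm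

theorem down_mul_down {k m ℓ : ℕ} (hℓ : ℓ ≤ m) (hm : m ≤ k) :
    down Ω k m * down Ω m ℓ = down Ω k ℓ := by
  induction hℓ using Nat.decreasingInduction with
  | self => rw [down_self, Matrix.mul_one]
  | of_succ ℓ hℓ ih =>
    rw [← down_mul_down_succ hℓ, ← Matrix.mul_assoc, ih, down_mul_down_succ (hℓ.trans_le hm)]

theorem vecMul_down_apply (k ℓ : ℕ) (μ : Slice Ω k → ℝ) (B : Slice Ω ℓ) :
    (μ ᵥ* down Ω k ℓ) B = (∑ A : Slice Ω k with B.1 ⊆ A.1, μ A) * (1 / (k.choose ℓ : ℝ)) := by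
  rw [sum_mul, sum_filter]
  exact sum_congr rfl fun A _ => by simp only [down, mul_ite, mul_zero]

theorem up_nonneg {k : ℕ} (ℓ : ℕ) {μ : Slice Ω k → ℝ} (hμ : 0 ≤ μ) (B : Slice Ω ℓ)
    (A : Slice Ω k) : 0 ≤ up ℓ μ B A := by
  unfold up
  split_ifs
  · exact div_nonneg (hμ A) (sum_nonneg fun A' _ => hμ A')
  · rfl

theorem sum_up {k ℓ : ℕ} {μ : Slice Ω k → ℝ} {B : Slice Ω ℓ} (hB : (μ ᵥ* down Ω k ℓ) B ≠ 0) :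
    ∑ A, up ℓ μ B A = 1 := by
  rw [vecMul_down_apply] at hB
  unfold up
  rw [← sum_filter, ← sum_div, div_self (left_ne_zero_of_mul hB)]

theorem Contracts.downUpWalk {f : ℝ → ℝ} (hf : ConvexOn ℝ (Set.Ici 0) f) {k ℓ : ℕ} {ρ : ℝ}
    {μ : Slice Ω k → ℝ} (hμ : 0 ≤ μ) (h : Contracts f (down Ω k ℓ) ρ μ) :
    Contracts f (downUpWalk ℓ μ) ρ μ := by
  intro ν hν hνμ
  refine le_trans ?_ (h ν hν hνμ)
  rw [DownUp.downUpWalk, ← Matrix.vecMul_vecMul, ← Matrix.vecMul_vecMul]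
  exact fDiv_vecMul_le hf (vecMul_nonneg hμ (down_nonneg k ℓ))
    (vecMul_nonneg hν.1 (down_nonneg k ℓ)) (up_nonneg ℓ hμ) (fun B hB => sum_up hB)
    fun B => vecMul_eq_zero_of_vecMul_eq_zero hμ (down_nonneg k ℓ) hνμ

end Down

section Homogenization

variable {n : ℕ} {Ω' : Fin n → Type*}

/-- The set `{(i, σ i) | i ∈ S}`, which is the restriction of the point `σ` of the product space to
the coordinates in `S`, seen as a set of elements of the disjoint union. -/
def graph (S : Finset (Fin n)) (σ : ∀ i, Ω' i) : Finset (Σ i, Ω' i) :=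
  S.map ⟨fun i => ⟨i, σ i⟩, fun _ _ h => congrArg Sigma.fst h⟩

theorem card_graph (S : Finset (Fin n)) (σ : ∀ i, Ω' i) : #(graph S σ) = #S := card_map _

theorem mem_graph {S : Finset (Fin n)} {σ : ∀ i, Ω' i} {a : Σ i, Ω' i} :
    a ∈ graph S σ ↔ a.1 ∈ S ∧ σ a.1 = a.2 := by
  rw [graph, mem_map]
  constructor
  · rintro ⟨i, hi, rfl⟩
    exact ⟨hi, rfl⟩
  · rintro ⟨hi, h⟩
    exact ⟨a.1, hi, Sigma.ext rfl (heq_of_eq h)⟩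

theorem mk_mem_graph {S : Finset (Fin n)} {i : Fin n} (hi : i ∈ S) (σ : ∀ i, Ω' i) :
    (⟨i, σ i⟩ : Σ i, Ω' i) ∈ graph S σ := mem_graph.2 ⟨hi, rfl⟩

theorem graph_eq_filter_comp_graph {S T : Finset (Fin n)} (h : T ⊆ S) :
    graph (Ω' := Ω') T = filter (fun a => a.1 ∈ T) ∘ graph S := by
  ext σ a
  simp only [Function.comp_apply, mem_filter, mem_graph]
  exact ⟨fun ⟨h₁, h₂⟩ => ⟨⟨h h₁, h₂⟩, h₁⟩, fun ⟨⟨_, h₁⟩, h₂⟩ => ⟨h₂, h₁⟩⟩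

theorem eq_of_graph_eq_graph {S T : Finset (Fin n)} {σ τ : ∀ i, Ω' i}
    (h : graph S σ = graph T τ) : S = T := by
  ext i
  exact ⟨fun hi => (mem_graph.1 (h ▸ mk_mem_graph hi σ)).1,
    fun hi => (mem_graph.1 (h ▸ mk_mem_graph hi τ)).1⟩

theorem graph_univ_injective : Function.Injective (graph (Ω' := Ω') univ) :=
  fun _ τ h => funext fun i => (mem_graph.1 (h ▸ mk_mem_graph (mem_univ i) τ)).2

theorem expect_powersetCard_graph (S : Finset (Fin n)) (σ : ∀ i, Ω' i) (k : ℕ)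
    (F : Finset (Σ i, Ω' i) → ℝ) :
    𝔼 A ∈ (graph S σ).powersetCard k, F A = 𝔼 T ∈ S.powersetCard k, F (graph T σ) := by
  rw [expect_eq_sum_div_card, expect_eq_sum_div_card, card_powersetCard, card_graph,
    card_powersetCard, graph, powersetCard_map, sum_map]
  rfl

variable [∀ i, Fintype (Ω' i)] [∀ i, DecidableEq (Ω' i)] {μ : (∀ i, Ω' i) → ℝ}

theorem sum_homogenization (F : Slice (Σ i, Ω' i) n → ℝ) :
    ∑ A, homogenization μ A * F A = ∑ σ, μ σ * F (toSlice σ) := by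
  simp only [homogenization, sum_mul, sum_filter]
  rw [sum_comm]
  simp only [ite_mul, zero_mul, sum_ite_eq, mem_univ, if_true]

theorem homLevel_self : homLevel μ n = homogenization μ := by
  rw [homLevel, down_self, Matrix.vecMul_one]

theorem homLevel_mem_stdSimplex (hμ : μ ∈ stdSimplex ℝ (∀ i, Ω' i)) {k : ℕ} (hk : k ≤ n) :
    homLevel μ k ∈ stdSimplex ℝ (Slice (Σ i, Ω' i) k) := by
  refine vecMul_mem_stdSimplex ⟨fun A => sum_nonneg fun σ _ => hμ.1 σ, ?_⟩ (down_nonneg n k)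
    (sum_down hk)
  simpa only [mul_one, hμ.2] using sum_homogenization (μ := μ) fun _ => 1

theorem homLevel_vecMul_down {k ℓ : ℕ} (hℓ : ℓ ≤ k) (hk : k ≤ n) :
    homLevel μ k ᵥ* down (Σ i, Ω' i) k ℓ = homLevel μ ℓ := by
  rw [homLevel, Matrix.vecMul_vecMul, down_mul_down hℓ hk, homLevel]

theorem sum_homLevel_mul (k : ℕ) (F : Finset (Σ i, Ω' i) → ℝ) :
    ∑ A : Slice (Σ i, Ω' i) k, homLevel μ k A * F A.1
      = 𝔼 S ∈ powersetCard k univ, ∑ σ, μ σ * F (graph S σ) := by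
  calc ∑ A : Slice (Σ i, Ω' i) k, homLevel μ k A * F A.1
      = ∑ B, homogenization μ B * (down (Σ i, Ω' i) n k *ᵥ fun A => F A.1) B :=
        (Matrix.dotProduct_mulVec _ _ _).symm
    _ = ∑ σ, μ σ * 𝔼 A ∈ (graph univ σ).powersetCard k, F A := by
        rw [sum_homogenization]
        exact sum_congr rfl fun σ _ => congrArg _ (down_mulVec n k F (toSlice σ))
    _ = 𝔼 S ∈ powersetCard k univ, ∑ σ, μ σ * F (graph S σ) := by
        simp only [expect_powersetCard_graph, mul_expect, expect_sum_comm]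

theorem expect_sum_mul_ite_graph (V : Finset (Fin n) → (∀ i, Ω' i) → ℝ) (T : Finset (Fin n))
    (τ : ∀ i, Ω' i) :
    𝔼 S ∈ powersetCard #T univ, ∑ σ, V S σ * (if graph S σ = graph T τ then 1 else 0)
      = (∑ σ with graph T σ = graph T τ, V T σ) / (n.choose #T : ℝ) := by
  simp only [mul_ite, mul_one, mul_zero, ← sum_filter]
  rw [expect_eq_sum_div_card, card_powersetCard, card_univ, Fintype.card_fin]
  congr 1
  refine sum_eq_single_of_mem T (mem_powersetCard_univ.2 rfl) fun S _ hST => ?_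
  rw [filter_false_of_mem fun σ _ h => hST (eq_of_graph_eq_graph h), sum_empty]

theorem homLevel_graph (T : Finset (Fin n)) (τ : ∀ i, Ω' i) :
    homLevel μ #T ⟨graph T τ, card_graph T τ⟩
      = (∑ σ with graph T σ = graph T τ, μ σ) / (n.choose #T : ℝ) := by
  rw [← expect_sum_mul_ite_graph (fun _ => μ), ← sum_homLevel_mul #T fun A =>
    if A = graph T τ then 1 else 0, sum_eq_single ⟨graph T τ, card_graph T τ⟩]
  · simp only [if_true, mul_one]
  · exact fun A _ hA => by rw [if_neg fun h => hA (Subtype.ext h), mul_zero]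
  · exact fun h => absurd (mem_univ _) h

theorem vecMul_down_apply_eq_expect {j : ℕ} {g : Finset (Σ i, Ω' i) → ℝ}
    {ν : Slice (Σ i, Ω' i) (j + 1) → ℝ} (hν : ∀ A, ν A = homLevel μ (j + 1) A * g A.1)
    (B : Slice (Σ i, Ω' i) j) :
    (ν ᵥ* down (Σ i, Ω' i) (j + 1) j) B = 𝔼 T ∈ powersetCard j univ,
      ∑ σ, μ σ * upAvg (fun S => g (graph S σ)) T * (if graph T σ = B.1 then 1 else 0) := by
  let F : Finset (Σ i, Ω' i) → ℝ := fun T => if T = B.1 then 1 else 0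
  calc (ν ᵥ* down (Σ i, Ω' i) (j + 1) j) B
      = ∑ A, homLevel μ (j + 1) A * (g A.1 * 𝔼 T ∈ A.1.powersetCard j, F T) :=
        sum_congr rfl fun A _ => by simp only [hν, down_apply, mul_assoc, F]
    _ = 𝔼 S ∈ powersetCard (j + 1) univ,
          ∑ σ, μ σ * (g (graph S σ) * 𝔼 T ∈ (graph S σ).powersetCard j, F T) :=
        sum_homLevel_mul (j + 1) fun A => g A * 𝔼 T ∈ A.powersetCard j, F T
    _ = ∑ σ, μ σ * 𝔼 S ∈ powersetCard (j + 1) univ,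
          𝔼 i ∈ S, g (graph (insert i (S.erase i)) σ) * F (graph (S.erase i) σ) := by
        rw [expect_sum_comm]
        refine sum_congr rfl fun σ _ => ?_
        rw [← mul_expect]
        refine congrArg _ (expect_congr rfl fun S hS => ?_)
        rw [expect_powersetCard_graph, expect_powersetCard_of_card_eq_succ
          (mem_powersetCard.1 hS).2 fun T => F (graph T σ), mul_expect]
        exact expect_congr rfl fun i hi => by rw [insert_erase hi]
    _ = ∑ σ, μ σ * 𝔼 T ∈ powersetCard j univ,
          upAvg (fun S => g (graph S σ)) T * F (graph T σ) := by
        refine sum_congr rfl fun σ _ => congrArg _ ?_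
        rw [expect_powersetCard_succ_erase univ j fun i T =>
          g (graph (insert i T) σ) * F (graph T σ)]
        simp only [upAvg, compl_eq_univ_sdiff, expect_mul]
    _ = _ := by simp only [mul_expect, mul_assoc, expect_sum_comm, F]

theorem vecMul_down_div_homLevel {T : Finset (Fin n)} {g : Finset (Σ i, Ω' i) → ℝ}
    {ν : Slice (Σ i, Ω' i) (#T + 1) → ℝ} (hν : ∀ A, ν A = homLevel μ (#T + 1) A * g A.1)
    (τ : ∀ i, Ω' i) :
    (ν ᵥ* down (Σ i, Ω' i) (#T + 1) #T) ⟨graph T τ, card_graph T τ⟩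
        / homLevel μ #T ⟨graph T τ, card_graph T τ⟩
      = condMean μ (graph T) (fun σ => upAvg (fun S => g (graph S σ)) T) τ := by
  have hT : (n.choose #T : ℝ) ≠ 0 :=
    Nat.cast_ne_zero.2 (Nat.choose_pos (card_finset_fin_le T)).ne'
  rw [vecMul_down_apply_eq_expect hν, homLevel_graph,
    expect_sum_mul_ite_graph fun T σ => μ σ * upAvg (fun S => g (graph S σ)) T,
    div_div_div_cancel_right₀ hT, condMean]

theorem fDiv_homLevel (f : ℝ → ℝ) {k : ℕ} {ν : Slice (Σ i, Ω' i) k → ℝ}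
    {U : Finset (Fin n) → (∀ i, Ω' i) → ℝ}
    (hU : ∀ S σ (h : #S = k), ν ⟨graph S σ, (card_graph S σ).trans h⟩
      / homLevel μ k ⟨graph S σ, (card_graph S σ).trans h⟩ = U S σ) :
    fDiv f ν (homLevel μ k) = 𝔼 S ∈ powersetCard k univ, ∑ σ, μ σ * f (U S σ) := by
  let F : Finset (Σ i, Ω' i) → ℝ :=
    Function.extend Subtype.val (fun A : Slice (Σ i, Ω' i) k => f (ν A / homLevel μ k A)) 0
  have hF (A : Slice (Σ i, Ω' i) k) : F A.1 = f (ν A / homLevel μ k A) :=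
    Subtype.val_injective.extend_apply _ _ A
  simp only [fDiv, ← hF]
  rw [sum_homLevel_mul]
  refine expect_congr rfl fun S hS => sum_congr rfl fun σ _ => ?_
  have hS := mem_powersetCard_univ.1 hS
  rw [← hU S σ hS, ← hF]

theorem fDiv_vecMul_down (f : ℝ → ℝ) {j : ℕ} (hj : j < n) {g : Finset (Σ i, Ω' i) → ℝ}
    {ν : Slice (Σ i, Ω' i) (j + 1) → ℝ} (hν : ∀ A, ν A = homLevel μ (j + 1) A * g A.1) :
    fDiv f (ν ᵥ* down (Σ i, Ω' i) (j + 1) j) (homLevel μ (j + 1) ᵥ* down (Σ i, Ω' i) (j + 1) j)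
      = 𝔼 T ∈ powersetCard j univ,
          ∑ σ, μ σ * f (condMean μ (graph T) (fun σ => upAvg (fun S => g (graph S σ)) T) σ) := by
  rw [homLevel_vecMul_down j.le_succ hj]
  refine fDiv_homLevel f fun T τ hT => ?_
  subst hT
  exact vecMul_down_div_homLevel hν τ

end Homogenization

section Tensorization

variable {n : ℕ} {Ω' : Fin n → Type*} [∀ i, Fintype (Ω' i)] [∀ i, DecidableEq (Ω' i)]
  {φ : ℝ → ℝ} {μ : (∀ i, Ω' i) → ℝ} {C : ℝ} {d : ℕ}

/-- Approximate tensorization of the `φ`-entropy: the entropy of a function is at most `C` times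
the sum over the coordinates `i` of its expected conditional entropy given the other coordinates,
here written as the drop in entropy under conditioning. -/
def ApproxTensorizes (φ : ℝ → ℝ) (μ : (∀ i, Ω' i) → ℝ) (C : ℝ) : Prop :=
  ∀ u : (∀ i, Ω' i) → ℝ, 0 ≤ u → phiEntropy φ μ u
    ≤ C * ∑ i, (phiEntropy φ μ u - phiEntropy φ μ (condMean μ (graph (univ.erase i)) u))

theorem expect_phiEntropy_condMean_le_of_contracts (hn : n ≠ 0) (hφ₁ : φ 1 = 0)
    (hμ : μ ∈ stdSimplex ℝ (∀ i, Ω' i)) {ρ : ℝ}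
    (h : Contracts φ (down (Σ i, Ω' i) n (n - 1)) ρ (homogenization μ))
    {u : (∀ i, Ω' i) → ℝ} (hu : 0 ≤ u) (hu₁ : ∑ σ, μ σ * u σ = 1) :
    𝔼 i, phiEntropy φ μ (condMean μ (graph (univ.erase i)) u) ≤ ρ * phiEntropy φ μ u := by
  obtain ⟨j, rfl⟩ := Nat.exists_eq_add_one_of_ne_zero hn
  let g : Finset (Σ i, Ω' i) → ℝ := Function.extend (graph univ) u 0
  have hgu (σ : ∀ i, Ω' i) : g (graph univ σ) = u σ := graph_univ_injective.extend_apply u 0 σ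
  have hg : 0 ≤ g := Function.extend_nonneg hu le_rfl
  let ν : Slice (Σ i, Ω' i) (j + 1) → ℝ := fun A => homogenization μ A * g A.1
  have sum_hom (F : Finset (Σ i, Ω' i) → ℝ) :
      ∑ A, homogenization μ A * F A.1 = ∑ σ, μ σ * F (graph univ σ) :=
    sum_homogenization fun A => F A.1
  have hν : ν ∈ stdSimplex ℝ (Slice (Σ i, Ω' i) (j + 1)) := by
    refine ⟨fun A => mul_nonneg (sum_nonneg fun σ _ => hμ.1 σ) (hg _), ?_⟩
    rw [sum_hom g]
    simpa only [hgu] using hu₁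
  have source : fDiv φ ν (homogenization μ) = phiEntropy φ μ u := by
    rw [fDiv_eq_sum_mul_map φ fun _ => rfl, sum_hom fun A => φ (g A)]
    simp only [hgu, phiEntropy, hu₁, hφ₁, sub_zero]
  have target : fDiv φ (ν ᵥ* down (Σ i, Ω' i) (j + 1) j)
      (homogenization μ ᵥ* down (Σ i, Ω' i) (j + 1) j)
      = 𝔼 i, phiEntropy φ μ (condMean μ (graph (univ.erase i)) u) := by
    rw [← homLevel_self, fDiv_vecMul_down φ j.lt_succ_self (g := g)
      fun A => by rw [homLevel_self],
      expect_powersetCard_of_card_eq_succ (card_fin (j + 1))]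
    simp only [upAvg_erase_univ, hgu, phiEntropy, sum_condMean hμ.1, hu₁, hφ₁, sub_zero]
  rw [← source, ← target]
  exact h ν hν fun A hA => by simp only [ν, hA, zero_mul]

theorem approxTensorizes_of_contracts (hn : n ≠ 0) (hC : 0 < C) (hφ₁ : φ 1 = 0)
    (hμ : μ ∈ stdSimplex ℝ (∀ i, Ω' i))
    (hd : ∀ c u, phiEntropy φ μ (c • u) = c ^ d * phiEntropy φ μ u)
    (h : Contracts φ (down (Σ i, Ω' i) n (n - 1)) (1 - 1 / (C * n)) (homogenization μ)) :
    ApproxTensorizes φ μ C := by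
  intro u hu
  rcases (sum_nonneg fun σ _ => mul_nonneg (hμ.1 σ) (hu σ)).eq_or_lt' with hm | hm
  · have h₀ (i : Fin n) : phiEntropy φ μ (condMean μ (graph (univ.erase i)) u) = 0 :=
      phiEntropy_eq_zero hμ (condMean_nonneg hμ.1 _ hu) ((sum_condMean hμ.1 _ u).trans hm)
    simp only [h₀, phiEntropy_eq_zero hμ hu hm, sub_zero, sum_const_zero, mul_zero, le_refl]
  set m := ∑ σ, μ σ * u σ
  have normalized := expect_phiEntropy_condMean_le_of_contracts hn hφ₁ hμ h
    (u := m⁻¹ • u) (smul_nonneg (inv_nonneg.2 hm.le) hu) (by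
      simp only [Pi.smul_apply, smul_eq_mul, mul_left_comm (μ _), ← mul_sum]
      exact inv_mul_cancel₀ hm.ne')
  simp only [condMean_smul, hd, ← mul_expect] at normalized
  rw [mul_left_comm] at normalized
  have scaled := le_of_mul_le_mul_left normalized (by positivity)
  have hn₀ : (0 : ℝ) < n := Nat.cast_pos.2 (Nat.pos_of_ne_zero hn)
  rw [expect_eq_sum_div_card, card_univ, Fintype.card_fin, div_le_iff₀ hn₀] at scaled
  rw [sum_sub_distrib, sum_const, card_univ, Fintype.card_fin, nsmul_eq_mul]
  have cancel : C * ((1 - 1 / (C * n)) * phiEntropy φ μ u * n)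
      = C * (n * phiEntropy φ μ u) - phiEntropy φ μ u := by field_simp
  linarith [mul_le_mul_of_nonneg_left scaled hC.le]

theorem ApproxTensorizes.phiEntropy_comp_graph_le (h : ApproxTensorizes φ μ C) (hC : 0 ≤ C)
    (hφ : ConvexOn ℝ (Set.Ici 0) φ) (hμ : 0 ≤ μ) {g : Finset (Σ i, Ω' i) → ℝ} (hg : 0 ≤ g)
    (S : Finset (Fin n)) :
    phiEntropy φ μ (g ∘ graph S) ≤ C * ∑ i ∈ S, (phiEntropy φ μ (g ∘ graph S)
      - phiEntropy φ μ (condMean μ (graph (S.erase i)) (g ∘ graph S))) := by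
  set u := g ∘ graph S with hu
  have hu₀ : 0 ≤ u := fun σ => hg _
  have outside : ∀ i, i ∉ S → phiEntropy φ μ u
      - phiEntropy φ μ (condMean μ (graph (univ.erase i)) u) = 0 := fun i hi => by
    have hS : S ⊆ univ.erase i := fun k hk => mem_erase.2 ⟨ne_of_mem_of_not_mem hk hi, mem_univ k⟩
    rw [sub_eq_zero]
    refine phiEntropy_congr fun σ hσ => ?_
    rw [hu, graph_eq_filter_comp_graph hS, ← Function.comp_assoc, condMean_comp hμ _ _ hσ]
    rfl
  refine (h u hu₀).trans (mul_le_mul_of_nonneg_left ?_ hC)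
  rw [← sum_subset (subset_univ S) fun i _ hi => outside i hi]
  refine sum_le_sum fun i _ => sub_le_sub_left ?_ _
  rw [graph_eq_filter_comp_graph (erase_subset_erase i (subset_univ S))]
  exact phiEntropy_condMean_comp_le hφ hμ _ _ hu₀

end Tensorization

section LocalToGlobal

variable {n : ℕ} {Ω' : Fin n → Type*} [∀ i, Fintype (Ω' i)] [∀ i, DecidableEq (Ω' i)]
  {φ : ℝ → ℝ} {μ : (∀ i, Ω' i) → ℝ} {C : ℝ} {g : Finset (Σ i, Ω' i) → ℝ}

theorem ApproxTensorizes.expect_phiEntropy_condMean_erase_le (h : ApproxTensorizes φ μ C)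
    (hC : 0 < C) (hφ : ConvexOn ℝ (Set.Ici 0) φ) (hμ : 0 ≤ μ) (hg : 0 ≤ g)
    {S : Finset (Fin n)} (hS : S.Nonempty) :
    𝔼 i ∈ S, phiEntropy φ μ (condMean μ (graph (S.erase i)) (g ∘ graph S))
      ≤ (1 - 1 / (C * #S)) * phiEntropy φ μ (g ∘ graph S) := by
  have hS₀ : (0 : ℝ) < #S := Nat.cast_pos.2 (card_pos.2 hS)
  have htens := h.phiEntropy_comp_graph_le hC.le hφ hμ hg S
  rw [sum_sub_distrib, sum_const, nsmul_eq_mul] at htens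
  rw [expect_eq_sum_div_card, div_le_iff₀ hS₀]
  refine le_of_mul_le_mul_left ?_ hC
  have cancel : C * ((1 - 1 / (C * #S)) * phiEntropy φ μ (g ∘ graph S) * #S)
      = C * (#S * phiEntropy φ μ (g ∘ graph S)) - phiEntropy φ μ (g ∘ graph S) := by field_simp
  linarith

theorem phiEntropy_condMean_upAvg_le (hφ : ConvexOn ℝ (Set.Ici 0) (phiEntropy φ μ))
    (hμ : 0 ≤ μ) (hg : 0 ≤ g) {T : Finset (Fin n)} (hT : Tᶜ.Nonempty) :
    phiEntropy φ μ (condMean μ (graph T) fun σ => upAvg (fun S => g (graph S σ)) T)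
      ≤ 𝔼 i ∈ Tᶜ, phiEntropy φ μ (condMean μ (graph T) (g ∘ graph (insert i T))) := by
  have avg : (fun σ => upAvg (fun S => g (graph S σ)) T)
      = 𝔼 i ∈ Tᶜ, g ∘ graph (insert i T) := by
    ext σ
    simp only [upAvg, expect_apply, Function.comp_apply]
  rw [avg, condMean_expect]
  exact map_expect_le hφ hT fun i _ => condMean_nonneg hμ _ fun _ => hg _

theorem ApproxTensorizes.expect_phiEntropy_le (h : ApproxTensorizes φ μ C) (hC : 0 < C)
    (hφ : ConvexOn ℝ (Set.Ici 0) φ) (hent : ConvexOn ℝ (Set.Ici 0) (phiEntropy φ μ))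
    (hμ : 0 ≤ μ) (hg : 0 ≤ g) {j : ℕ} (hj : j < n) :
    𝔼 T ∈ powersetCard j univ,
        phiEntropy φ μ (condMean μ (graph T) fun σ => upAvg (fun S => g (graph S σ)) T)
      ≤ (1 - 1 / (C * (j + 1 : ℕ)))
        * 𝔼 S ∈ powersetCard (j + 1) univ, phiEntropy φ μ (g ∘ graph S) := by
  calc 𝔼 T ∈ powersetCard j univ,
        phiEntropy φ μ (condMean μ (graph T) fun σ => upAvg (fun S => g (graph S σ)) T)
      ≤ 𝔼 T ∈ powersetCard j univ, 𝔼 i ∈ univ \ T,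
          phiEntropy φ μ (condMean μ (graph T) (g ∘ graph (insert i T))) := by
        refine expect_le_expect fun T hT => ?_
        rw [← compl_eq_univ_sdiff]
        refine phiEntropy_condMean_upAvg_le hent hμ hg (card_pos.1 ?_)
        rw [card_compl, Fintype.card_fin, mem_powersetCard_univ.1 hT]
        exact Nat.sub_pos_of_lt hj
    _ = 𝔼 S ∈ powersetCard (j + 1) univ, 𝔼 i ∈ S,
          phiEntropy φ μ (condMean μ (graph (S.erase i)) (g ∘ graph S)) := by
        rw [← expect_powersetCard_succ_erase univ j fun i T =>
          phiEntropy φ μ (condMean μ (graph T) (g ∘ graph (insert i T)))]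
        exact expect_congr rfl fun S _ => expect_congr rfl fun i hi => by rw [insert_erase hi]
    _ ≤ _ := by
        rw [mul_expect]
        refine expect_le_expect fun S hS => ?_
        have hcard := mem_powersetCard_univ.1 hS
        rw [← hcard]
        exact h.expect_phiEntropy_condMean_erase_le hC hφ hμ hg
          (card_pos.1 (hcard ▸ j.succ_pos))

theorem ApproxTensorizes.contracts_down (h : ApproxTensorizes φ μ C) (hC : 0 < C)
    (hφ : ConvexOn ℝ (Set.Ici 0) φ) (hent : ConvexOn ℝ (Set.Ici 0) (phiEntropy φ μ))
    (hμ : μ ∈ stdSimplex ℝ (∀ i, Ω' i)) {j : ℕ} (hj : j < n) {ρ : ℝ}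
    (hρ : 1 - 1 / (C * (j + 1 : ℕ)) ≤ ρ) (hJ : JohnsonContracts φ (Fin n) j ρ) :
    Contracts φ (down (Σ i, Ω' i) (j + 1) j) ρ (homLevel μ (j + 1)) := by
  intro ν hν hνμ
  have hlevel := homLevel_mem_stdSimplex hμ (Nat.succ_le_of_lt hj)
  let g : Finset (Σ i, Ω' i) → ℝ :=
    Function.extend Subtype.val (fun A => ν A / homLevel μ (j + 1) A) 0
  have hg : 0 ≤ g := Function.extend_nonneg (fun A => div_nonneg (hν.1 A) (hlevel.1 A)) le_rfl
  have hνg (A : Slice (Σ i, Ω' i) (j + 1)) : ν A = homLevel μ (j + 1) A * g A.1 := by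
    rw [show g A.1 = _ from Subtype.val_injective.extend_apply _ _ A,
      mul_div_cancel_of_imp' (hνμ A)]
  let m : Finset (Fin n) → ℝ := fun S => ∑ σ, μ σ * g (graph S σ)
  have hm : 0 ≤ m := fun S => sum_nonneg fun σ _ => mul_nonneg (hμ.1 σ) (hg _)
  have hm₁ : 𝔼 S ∈ powersetCard (j + 1) univ, m S = 1 := by
    simp only [m, ← sum_homLevel_mul, ← hνg, hν.2]
  have mean (T : Finset (Fin n)) : ∑ σ, μ σ * upAvg (fun S => g (graph S σ)) T = upAvg m T := by
    simp only [upAvg, mul_expect, m, expect_sum_comm]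
  have entropy := h.expect_phiEntropy_le hC hφ hent hμ.1 hg hj
  have entropy_nonneg : 0 ≤ 𝔼 S ∈ powersetCard (j + 1) univ, phiEntropy φ μ (g ∘ graph S) :=
    expect_nonneg fun S _ => phiEntropy_nonneg hφ hμ fun σ => hg _
  rw [fDiv_vecMul_down φ hj hνg, fDiv_eq_sum_mul_map φ hνg,
    sum_homLevel_mul (j + 1) fun A => φ (g A), expect_sum_mul_map,
    expect_sum_mul_map _ fun S σ => g (graph S σ), mul_add]
  simp only [sum_condMean hμ.1, mean]
  exact add_le_add (entropy.trans (mul_le_mul_of_nonneg_right hρ entropy_nonneg)) (hJ m hm hm₁)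

theorem contracts_down_prod (hμ : μ ∈ stdSimplex ℝ (∀ i, Ω' i)) {ρ : ℕ → ℝ}
    (hρ : ∀ j < n, 0 ≤ ρ (j + 1))
    (h : ∀ j < n, Contracts φ (down (Σ i, Ω' i) (j + 1) j) (ρ (j + 1)) (homLevel μ (j + 1)))
    {k ℓ : ℕ} (hℓ : ℓ ≤ k) (hk : k ≤ n) :
    Contracts φ (down (Σ i, Ω' i) k ℓ) (∏ j ∈ Icc (ℓ + 1) k, ρ j) (homLevel μ k) := by
  induction hℓ using Nat.decreasingInduction with
  | self =>
    intro ν _ _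
    rw [down_self, Matrix.vecMul_one, Matrix.vecMul_one, Icc_eq_empty_of_lt k.lt_succ_self,
      prod_empty, one_mul]
  | of_succ ℓ hℓ ih =>
    rw [Icc_add_one_left_eq_Ioc] at ih
    have hℓn := hℓ.trans_le hk
    rw [← down_mul_down_succ hℓ, ← mul_prod_Ioc_eq_prod_Icc hℓ]
    refine ih.mul ?_ (homLevel_mem_stdSimplex hμ hk).1 (down_nonneg k (ℓ + 1)) (sum_down hℓ)
      (hρ ℓ hℓn)
    rw [homLevel_vecMul_down hℓ hk]
    exact h ℓ hℓn

theorem contracts_down_and_downUpWalk (hC : 0 < C) (hφ : ConvexOn ℝ (Set.Ici 0) φ)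
    (hφ₁ : φ 1 = 0) (hμ : μ ∈ stdSimplex ℝ (∀ i, Ω' i))
    (hent : ConvexOn ℝ (Set.Ici 0) (phiEntropy φ μ)) {d : ℕ}
    (hd : ∀ c u, phiEntropy φ μ (c • u) = c ^ d * phiEntropy φ μ u) {a : ℕ → ℝ}
    (ha : ∀ j < n, 1 ≤ (j + 1 : ℕ) * a (j + 1))
    (hJ : ∀ j < n, JohnsonContracts φ (Fin n) j (1 - 1 / ((j + 1 : ℕ) * a (j + 1))))
    (h : Contracts φ (down (Σ i, Ω' i) n (n - 1)) (1 - 1 / (C * n)) (homogenization μ))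
    {k ℓ : ℕ} (hℓ : ℓ ≤ k) (hk : k ≤ n) :
    Contracts φ (down (Σ i, Ω' i) k ℓ)
        (∏ j ∈ Icc (ℓ + 1) k, (1 - 1 / ((j : ℝ) * max C (a j)))) (homLevel μ k) ∧
      Contracts φ (downUpWalk ℓ (homLevel μ k))
        (∏ j ∈ Icc (ℓ + 1) k, (1 - 1 / ((j : ℝ) * max C (a j)))) (homLevel μ k) := by
  have hrate (j : ℕ) : ((j + 1 : ℕ) : ℝ) * a (j + 1) ≤ (j + 1 : ℕ) * max C (a (j + 1)) :=
    mul_le_mul_of_nonneg_left (le_max_right _ _) (Nat.cast_nonneg _)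
  have hdown := contracts_down_prod (φ := φ) hμ
    (ρ := fun j => 1 - 1 / ((j : ℝ) * max C (a j)))
    (fun j hj => sub_nonneg.2 (div_le_one_of_le₀ ((ha j hj).trans (hrate j))
      (zero_le_one.trans ((ha j hj).trans (hrate j)))))
    (fun j hj => by
      have htens := approxTensorizes_of_contracts (by omega) hC hφ₁ hμ hd h
      refine htens.contracts_down hC hφ hent hμ hj (sub_le_sub_left ?_ 1)
        ((hJ j hj).mono hφ hφ₁ (sub_le_sub_left ?_ 1))
      · rw [mul_comm C]
        exact one_div_le_one_div_of_le (by positivity)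
          (mul_le_mul_of_nonneg_left (le_max_left _ _) (Nat.cast_nonneg _))
      · exact one_div_le_one_div_of_le (zero_lt_one.trans_le (ha j hj)) (hrate j)) hℓ hk
  exact ⟨hdown, hdown.downUpWalk hφ (homLevel_mem_stdSimplex hμ hk).1⟩

end LocalToGlobal

theorem one_le_mul_sub_add_one_div {n j : ℕ} (hj : j < n) :
    1 ≤ ((j + 1 : ℕ) : ℝ) * (((n : ℝ) - (j + 1 : ℕ) + 1) / n) := by
  obtain ⟨r, rfl⟩ := Nat.exists_eq_add_of_lt hj
  rw [← mul_div_assoc, one_le_div (by positivity)]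
  push_cast
  nlinarith [mul_nonneg (Nat.cast_nonneg (α := ℝ) j) (Nat.cast_nonneg (α := ℝ) r)]

theorem prod_one_sub_le_prod_one_sub {C : ℝ} (hC : 0 ≤ C) {a : ℕ → ℝ} {n : ℕ}
    (ha : ∀ j < n, 1 ≤ (j + 1 : ℕ) * a (j + 1)) {k : ℕ} (hk : k ≤ n) (ℓ : ℕ) :
    ∏ j ∈ Icc (ℓ + 1) k, (1 - 1 / ((j : ℝ) * max C (a j)))
      ≤ ∏ j ∈ Icc (ℓ + 1) k, (1 - 1 / ((j : ℝ) * (C + a j))) := by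
  have bounds : ∀ j ∈ Icc (ℓ + 1) k,
      1 ≤ (j : ℝ) * max C (a j) ∧ (j : ℝ) * max C (a j) ≤ j * (C + a j) := by
    intro j hj
    rw [mem_Icc] at hj
    obtain ⟨i, rfl⟩ := Nat.exists_eq_add_one_of_ne_zero (show j ≠ 0 by omega)
    have hi := ha i (by omega)
    have ha₀ : 0 ≤ a (i + 1) :=
      (pos_of_mul_pos_right (zero_lt_one.trans_le hi) (Nat.cast_nonneg _)).le
    exact ⟨hi.trans (mul_le_mul_of_nonneg_left (le_max_right _ _) (Nat.cast_nonneg _)),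
      mul_le_mul_of_nonneg_left (max_le_add_of_nonneg hC ha₀) (Nat.cast_nonneg _)⟩
  refine prod_le_prod (fun j hj => ?_) fun j hj => ?_
  · exact sub_nonneg.2 (div_le_one_of_le₀ (bounds j hj).1 (zero_le_one.trans (bounds j hj).1))
  · exact sub_le_sub_left
      (one_div_le_one_div_of_le (zero_lt_one.trans_le (bounds j hj).1) (bounds j hj).2) 1

end DownUp

theorem theoremt_general {n : ℕ} {Ω' : Fin n → Type*} [∀ i, Fintype (Ω' i)]
    [∀ i, DecidableEq (Ω' i)] (μ : (∀ i, Ω' i) → ℝ) (hμ : μ ∈ stdSimplex ℝ (∀ i, Ω' i))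
    (C : ℝ) (hC : 0 < C) :
    (DownUp.Contracts DownUp.chiSqFun (DownUp.down (Σ i, Ω' i) n (n - 1)) (1 - 1 / (C * n))
        (DownUp.homogenization μ) →
      ∀ k ℓ : ℕ, ℓ ≤ k → k ≤ n →
        DownUp.Contracts DownUp.chiSqFun (DownUp.down (Σ i, Ω' i) k ℓ)
          (∏ j ∈ Finset.Icc (ℓ + 1) k,
            (1 - 1 / ((j : ℝ) * max C (((n : ℝ) - (j : ℝ) + 1) / (n : ℝ)))))
          (DownUp.homLevel μ k) ∧
        DownUp.Contracts DownUp.chiSqFun (DownUp.downUpWalk ℓ (DownUp.homLevel μ k))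
          (∏ j ∈ Finset.Icc (ℓ + 1) k,
            (1 - 1 / ((j : ℝ) * max C (((n : ℝ) - (j : ℝ) + 1) / (n : ℝ)))))
          (DownUp.homLevel μ k)) ∧
    (DownUp.Contracts DownUp.klFun (DownUp.down (Σ i, Ω' i) n (n - 1)) (1 - 1 / (C * n))
        (DownUp.homogenization μ) →
      ∀ k ℓ : ℕ, ℓ ≤ k → k ≤ n →
        DownUp.Contracts DownUp.klFun (DownUp.down (Σ i, Ω' i) k ℓ)
          (∏ j ∈ Finset.Icc (ℓ + 1) k, (1 - 1 / ((j : ℝ) * max C 1)))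
          (DownUp.homLevel μ k) ∧
        DownUp.Contracts DownUp.klFun (DownUp.downUpWalk ℓ (DownUp.homLevel μ k))
          (∏ j ∈ Finset.Icc (ℓ + 1) k, (1 - 1 / ((j : ℝ) * max C 1)))
          (DownUp.homLevel μ k)) := by
  constructor
  · refine fun h k ℓ => DownUp.contracts_down_and_downUpWalk
      (a := fun j : ℕ => ((n : ℝ) - j + 1) / n) hC DownUp.convexOn_chiSqFun DownUp.chiSqFun_one
      hμ (DownUp.convexOn_phiEntropy_chiSqFun hμ)
      (fun c u => DownUp.phiEntropy_chiSqFun_smul hμ.2 c)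
      (fun j hj => DownUp.one_le_mul_sub_add_one_div hj) (fun j hj => ?_) h
    simpa only [Fintype.card_fin] using
      DownUp.johnsonContracts_chiSqFun (hj.trans_eq (Fintype.card_fin n).symm)
  · refine fun h k ℓ => DownUp.contracts_down_and_downUpWalk (a := fun _ => 1) (d := 1)
      hC DownUp.convexOn_klFun DownUp.klFun_one hμ (DownUp.convexOn_phiEntropy_klFun hμ.1)
      (fun c u => by rw [pow_one, DownUp.phiEntropy_klFun_smul])
      (fun j _ => by simp) (fun j hj => ?_) h
    simpa only [mul_one] using
      DownUp.johnsonContracts_klFun (hj.trans_eq (Fintype.card_fin n).symm)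

theorem theoremt {n : ℕ} (hn : 1 ≤ n) {Ω' : Fin n → Type*} [∀ i, Fintype (Ω' i)]
    [∀ i, DecidableEq (Ω' i)] (μ : (∀ i, Ω' i) → ℝ) (hμ : μ ∈ stdSimplex ℝ (∀ i, Ω' i))
    (C : ℝ) (hC : 0 < C) :
    (DownUp.Contracts DownUp.chiSqFun (DownUp.down (Σ i, Ω' i) n (n - 1)) (1 - 1 / (C * n))
        (DownUp.homogenization μ) →
      ∀ k ℓ : ℕ, ℓ ≤ k → k ≤ n →
        DownUp.Contracts DownUp.chiSqFun (DownUp.down (Σ i, Ω' i) k ℓ)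
          (∏ j ∈ Finset.Icc (ℓ + 1) k,
            (1 - 1 / ((j : ℝ) * (C + ((n : ℝ) - (j : ℝ) + 1) / (n : ℝ)))))
          (DownUp.homLevel μ k)) ∧
    (DownUp.Contracts DownUp.klFun (DownUp.down (Σ i, Ω' i) n (n - 1)) (1 - 1 / (C * n))
        (DownUp.homogenization μ) →
      ∀ k ℓ : ℕ, ℓ ≤ k → k ≤ n →
        DownUp.Contracts DownUp.klFun (DownUp.down (Σ i, Ω' i) k ℓ)
          (∏ j ∈ Finset.Icc (ℓ + 1) k, (1 - 1 / ((j : ℝ) * (C + 1))))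
          (DownUp.homLevel μ k) ∧
        DownUp.Contracts DownUp.klFun (DownUp.downUpWalk ℓ (DownUp.homLevel μ k))
          (∏ j ∈ Finset.Icc (ℓ + 1) k, (1 - 1 / ((j : ℝ) * (C + 1))))
          (DownUp.homLevel μ k)) := by
  obtain ⟨chiSq, kl⟩ := theoremt_general μ hμ C hC
  have hmem {k : ℕ} (hk : k ≤ n) := DownUp.homLevel_mem_stdSimplex hμ hk
  refine ⟨fun h k ℓ hℓ hk => ?_, fun h k ℓ hℓ hk => ?_⟩
  · exact (chiSq h k ℓ hℓ hk).1.mono DownUp.convexOn_chiSqFun DownUp.chiSqFun_one (hmem hk)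
      (DownUp.prod_one_sub_le_prod_one_sub hC.le
        (fun j hj => DownUp.one_le_mul_sub_add_one_div hj) hk ℓ)
  · have rate_le := DownUp.prod_one_sub_le_prod_one_sub hC.le (a := fun _ => 1) (n := n)
      (fun j _ => by simp) hk ℓ
    obtain ⟨hdown, hwalk⟩ := kl h k ℓ hℓ hk
    exact ⟨hdown.mono DownUp.convexOn_klFun DownUp.klFun_one (hmem hk) rate_le,
      hwalk.mono DownUp.convexOn_klFun DownUp.klFun_one (hmem hk) rate_le⟩
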